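/- For $s,t\in\mathbb R$ let $D^s=(1-\Delta)^{s/2}$ and $L(t)=e^{-it\sqrt{1-\Delta}}$ be the Fourier multipliers on the tempered distributions $\mathcal S'(\mathbb R)$ with symbols $(1+n^2)^{s/2}$ and $e^{-it\sqrt{1+n^2}}$. Let $$H^{1/2-}_{\rm loc}=\{u\in\mathcal S'(\mathbb R)\;:\;D^su\in L^2_{\rm loc}(\mathbb R)\text{ for all }s<1/2\},\qquad p_{R,s}(u)=\Big(\int_{-R}^R|D^su|^2\,dx\Big)^{1/2},$$ with the distance $$d(u,v)=\sum_{k,l\ge1}2^{-(k+l)}\frac{p_{k,1/2-1/l}(u-v)}{1+p_{k,1/2-1/l}(u-v)}$$ and the Borel $\sigma$-algebra of $d$. Let $(W_n)_{n\in\mathbb R}$ be a two-sided complex Brownian motion on a probability space $(\Omega,\mathcal F,\mathbb P)$, normalised by $\mathbb E|W_n-W_m|^2=|n-m|$, and for $N\ge1$, $R\ge 0$ let $$\varphi_{N,R}(\omega,x)=\sum_{k=-NR}^{NR-1}\big(W_{(k+1)/N}(\omega)-W_{k/N}(\omega)\big)\Big(1+\tfrac{k^2}{N^2}\Big)^{-1/2}e^{ikx/N}.$$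 Then there is an $H^{1/2-}_{\rm loc}$-valued random variable $\varphi$ on $\Omega$, unique up to almost sure equality, written $\varphi(x)=\int(1+n^2)^{-1/2}e^{inx}\,dW_n$, such that for all $s<1/2$ $$\operatorname*{ess\,sup}_{x\in\mathbb R}\,(1+x^2)^{-1/2}\,\big\|D^s\varphi(\cdot,x)-D^s\varphi_{2^k,k}(\cdot,x)\big\|_{L^2(\Omega)}\longrightarrow0\qquad(k\to\infty),$$ for a jointly measurable version of $D^s\varphi$. The law $\mu$ of $\varphi$ on $H^{1/2-}_{\rm loc}$ is invariant under the linear Klein–Gordon flow: for every $t\in\mathbb R$ and every measurable $A\subseteq H^{1/2-}_{\rm loc}$, the set $L(t)^{-1}A=\{u\in H^{1/2-}_{\rm loc}: L(t)u\in A\}$ is $\mu$-measurable and $$\mu(L(t)^{-1}A)=\mu(A).$$ -/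

import Mathlib

open MeasureTheory ProbabilityTheory Filter Topology
open scoped SchwartzMap ENNReal NNReal FourierTransform

noncomputable section

namespace KleinGordon

/-! ### Fourier multipliers on tempered distributions

Mathlib's Fourier transform on `ℝ` has the kernel `exp (-2πi x ξ)`, so the wave `exp (i n x)` sits at
`ξ = n / (2π)`, and the multiplier with symbol `m n` is `fourierMultiplierCLM` of `ξ ↦ m (2πξ)`. -/

/-- The symbol `(1 + n²)^(s/2)` of `D^s = (1 - Δ)^(s/2)`, at `n = 2πξ`. -/
def besselSymbol (s ξ : ℝ) : ℂ := (((1 + (2 * Real.pi * ξ) ^ 2) ^ (s / 2) : ℝ) : ℂ)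

/-- The symbol `exp (-i t √(1 + n²))` of the linear Klein-Gordon flow, at `n = 2πξ`. -/
def flowSymbol (t ξ : ℝ) : ℂ :=
  Complex.exp (-(Complex.I * (t * Real.sqrt (1 + (2 * Real.pi * ξ) ^ 2) : ℝ)))

theorem besselSymbol_hasTemperateGrowth (s : ℝ) : (besselSymbol s).HasTemperateGrowth := by
  have h1 := Function.hasTemperateGrowth_one_add_norm_sq_rpow ℝ (s / 2)
  have h2 : (fun ξ : ℝ => 2 * Real.pi * ξ).HasTemperateGrowth := by fun_prop
  have h3 := (Function.Complex.hasTemperateGrowth_ofReal).comp (h1.comp h2)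
  have h4 : besselSymbol s =
      Complex.ofReal ∘ (fun x : ℝ => (1 + ‖x‖ ^ 2) ^ (s / 2)) ∘ fun ξ => 2 * Real.pi * ξ := by
    ext ξ
    simp only [besselSymbol, Function.comp_apply, Real.norm_eq_abs, sq_abs]
  rw [h4]
  exact h3

theorem flowSymbol_hasTemperateGrowth (t : ℝ) : (flowSymbol t).HasTemperateGrowth := by
  have h1 := Function.hasTemperateGrowth_one_add_norm_sq_rpow ℝ (1 / 2)
  have h2 : (fun ξ : ℝ => 2 * Real.pi * ξ).HasTemperateGrowth := by fun_prop
  have h3 : (fun ξ : ℝ => -t * (1 + ‖2 * Real.pi * ξ‖ ^ 2) ^ (1 / 2 : ℝ)).HasTemperateGrowth :=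
    (Function.HasTemperateGrowth.const (-t)).mul (h1.comp h2)
  have h4 : (fun y : ℝ => Complex.exp (y * Complex.I)).HasTemperateGrowth := by
    have hd : ∀ n : ℕ, iteratedDeriv n (fun y : ℝ => Complex.exp (y * Complex.I)) =
        fun y : ℝ => Complex.I ^ n * Complex.exp (y * Complex.I) := by
      intro n
      induction n with
      | zero => ext y; simp
      | succ n ih =>
        ext y
        rw [iteratedDeriv_succ, ih]
        have : HasDerivAt (fun y : ℝ => Complex.I ^ n * Complex.exp (y * Complex.I))
            (Complex.I ^ n * (Complex.exp (y * Complex.I) * (1 * Complex.I))) y :=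
          (((Complex.ofRealCLM.hasDerivAt (x := y)).mul_const Complex.I).cexp).const_mul _
        rw [this.deriv]
        ring
    refine ⟨?_, fun n => ⟨0, 1, fun x => ?_⟩⟩
    · exact Complex.contDiff_exp.comp (Complex.ofRealCLM.contDiff.mul contDiff_const)
    · rw [norm_iteratedFDeriv_eq_norm_iteratedDeriv, hd]
      simp [Complex.norm_exp_ofReal_mul_I]
  convert h4.comp h3 using 1
  ext ξ
  simp only [flowSymbol, Function.comp_def, Real.norm_eq_abs, sq_abs, Real.sqrt_eq_rpow]
  congr 1
  push_cast
  ring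

/-- `D^s = (1 - Δ)^(s/2)` on tempered distributions. -/
def besselD (s : ℝ) : 𝓢'(ℝ, ℂ) →L[ℂ] 𝓢'(ℝ, ℂ) :=
  TemperedDistribution.fourierMultiplierCLM ℂ (besselSymbol s)

/-- `L(t) = exp (-i t √(1 - Δ))` on tempered distributions. -/
def linFlow (t : ℝ) : 𝓢'(ℝ, ℂ) →L[ℂ] 𝓢'(ℝ, ℂ) :=
  TemperedDistribution.fourierMultiplierCLM ℂ (flowSymbol t)

/-! ### The space `H^{1/2-}_loc` -/

/-- The tempered distribution `T` is the function `g`, which lies in `L²_loc`. An `L²_loc` function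
may grow fast at infinity, hence the compactly supported test functions. -/
def IsL2LocRep (T : 𝓢'(ℝ, ℂ)) (g : ℝ → ℂ) : Prop :=
  (∀ R : ℝ, MemLp g 2 (volume.restrict (Set.Icc (-R) R))) ∧
    ∀ ψ : 𝓢(ℝ, ℂ), HasCompactSupport ψ → T ψ = ∫ x, ψ x * g x

open Classical in
/-- The `L²_loc` function (unique up to a null set) that `T` is, if there is one. -/
def l2LocRep (T : 𝓢'(ℝ, ℂ)) : ℝ → ℂ :=
  if h : ∃ g, IsL2LocRep T g then h.choose else 0

/-- `p_{R,s}(u) = (∫_{[-R,R]} |D^s u|²)^{1/2}`. -/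
def pNorm (R s : ℝ) (u : 𝓢'(ℝ, ℂ)) : ℝ :=
  (eLpNorm (l2LocRep (besselD s u)) 2 (volume.restrict (Set.Icc (-R) R))).toReal

/-- The space `H^{1/2-}_loc` of the tempered distributions `u` with `D^s u ∈ L²_loc` for all
`s < 1/2`. -/
structure HalfLoc where
  val : 𝓢'(ℝ, ℂ)
  mem : ∀ s : ℝ, s < 1 / 2 → ∃ g : ℝ → ℂ, IsL2LocRep (besselD s val) g

namespace HalfLoc

/-- `d(u,v) = ∑_{k,l ≥ 1} 2^{-(k+l)} p_{k,1/2-1/l}(u-v) / (1 + p_{k,1/2-1/l}(u-v))`; the index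
`(i, j)` of the sum stands for `(k, l) = (i+1, j+1)`. -/
def hdist (u v : HalfLoc) : ℝ :=
  ∑' i : ℕ × ℕ, (1 / 2 : ℝ) ^ ((i.1 + 1) + (i.2 + 1)) *
    (pNorm (i.1 + 1) (1 / 2 - 1 / (i.2 + 1)) (u.val - v.val) /
      (1 + pNorm (i.1 + 1) (1 / 2 - 1 / (i.2 + 1)) (u.val - v.val)))

end HalfLoc

theorem IsL2LocRep.l2LocRep {T : 𝓢'(ℝ, ℂ)} {g : ℝ → ℂ} (h : IsL2LocRep T g) :
    IsL2LocRep T (l2LocRep T) := by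
  have h' : ∃ g, IsL2LocRep T g := ⟨g, h⟩
  rw [KleinGordon.l2LocRep, dif_pos h']
  exact h'.choose_spec

theorem IsL2LocRep.integrable {T : 𝓢'(ℝ, ℂ)} {g : ℝ → ℂ} (h : IsL2LocRep T g) :
    LocallyIntegrable g := by
  intro x
  refine ⟨Set.Icc (-(|x| + 1)) (|x| + 1), ?_, ?_⟩
  · apply Icc_mem_nhds <;> [have := neg_abs_le x; have := le_abs_self x] <;> linarith
  · exact (h.1 (|x| + 1)).integrable (by norm_num)

theorem IsL2LocRep.ae_eq {T : 𝓢'(ℝ, ℂ)} {f g : ℝ → ℂ} (hf : IsL2LocRep T f)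
    (hg : IsL2LocRep T g) : f =ᵐ[volume] g := by
  refine ae_eq_of_integral_contDiff_smul_eq hf.integrable hg.integrable fun ψ hψ hc => ?_
  have hc' : HasCompactSupport (fun x => (ψ x : ℂ)) := hc.comp_left (g := fun y : ℝ => (y : ℂ)) rfl
  have hs : ContDiff ℝ (⊤ : ℕ∞) (fun x => (ψ x : ℂ)) := Complex.ofRealCLM.contDiff.comp hψ
  have h1 := hf.2 (hc'.toSchwartzMap hs) hc'
  have h2 := hg.2 (hc'.toSchwartzMap hs) hc'
  simpa [Complex.real_smul] using h1.symm.trans h2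

theorem IsL2LocRep.add {S T : 𝓢'(ℝ, ℂ)} {f g : ℝ → ℂ} (hf : IsL2LocRep S f)
    (hg : IsL2LocRep T g) : IsL2LocRep (S + T) (f + g) := by
  refine ⟨fun R => (hf.1 R).add (hg.1 R), fun ψ hψ => ?_⟩
  have hi := fun {f : ℝ → ℂ} (h : LocallyIntegrable f) =>
    h.integrable_smul_left_of_hasCompactSupport ψ.continuous hψ
  simp only [smul_eq_mul] at hi
  change S ψ + T ψ = _
  rw [hf.2 ψ hψ, hg.2 ψ hψ, ← integral_add (hi hf.integrable) (hi hg.integrable)]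
  simp [mul_add]

theorem IsL2LocRep.neg {T : 𝓢'(ℝ, ℂ)} {g : ℝ → ℂ} (hg : IsL2LocRep T g) :
    IsL2LocRep (-T) (-g) := by
  refine ⟨fun R => (hg.1 R).neg, fun ψ hψ => ?_⟩
  change -(T ψ) = _
  rw [hg.2 ψ hψ]
  simp [integral_neg]

theorem pNorm_nonneg (R s : ℝ) (u : 𝓢'(ℝ, ℂ)) : 0 ≤ pNorm R s u := ENNReal.toReal_nonneg

theorem pNorm_eq {R s : ℝ} {u : 𝓢'(ℝ, ℂ)} {g : ℝ → ℂ} (h : IsL2LocRep (besselD s u) g) :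
    pNorm R s u = (eLpNorm g 2 (volume.restrict (Set.Icc (-R) R))).toReal := by
  rw [pNorm, eLpNorm_congr_ae (ae_restrict_of_ae (h.l2LocRep.ae_eq h))]

theorem pNorm_add_le {R s : ℝ} {u v : 𝓢'(ℝ, ℂ)} {f g : ℝ → ℂ} (hf : IsL2LocRep (besselD s u) f)
    (hg : IsL2LocRep (besselD s v) g) : pNorm R s (u + v) ≤ pNorm R s u + pNorm R s v := by
  have h : IsL2LocRep (besselD s (u + v)) (f + g) := by
    rw [map_add]
    exact hf.add hg
  rw [pNorm_eq h, pNorm_eq hf, pNorm_eq hg,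
    ← ENNReal.toReal_add (hf.1 R).eLpNorm_ne_top (hg.1 R).eLpNorm_ne_top]
  exact ENNReal.toReal_mono
    (ENNReal.add_ne_top.2 ⟨(hf.1 R).eLpNorm_ne_top, (hg.1 R).eLpNorm_ne_top⟩)
    (eLpNorm_add_le (hf.1 R).1 (hg.1 R).1 (by norm_num))

theorem pNorm_zero (R s : ℝ) : pNorm R s 0 = 0 := by
  have h : IsL2LocRep (besselD s 0) 0 := by
    rw [map_zero]
    exact ⟨fun R => MemLp.zero, fun ψ _ => by simp⟩
  rw [pNorm_eq h]
  simp

theorem pNorm_neg {R s : ℝ} {u : 𝓢'(ℝ, ℂ)} {g : ℝ → ℂ} (h : IsL2LocRep (besselD s u) g) :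
    pNorm R s (-u) = pNorm R s u := by
  have h' : IsL2LocRep (besselD s (-u)) (-g) := by
    rw [map_neg]
    exact h.neg
  rw [pNorm_eq h', pNorm_eq h, eLpNorm_neg]

namespace HalfLoc

theorem exists_rep_sub (u v : HalfLoc) {s : ℝ} (hs : s < 1 / 2) :
    ∃ g : ℝ → ℂ, IsL2LocRep (besselD s (u.val - v.val)) g := by
  obtain ⟨f, hf⟩ := u.mem s hs
  obtain ⟨g, hg⟩ := v.mem s hs
  refine ⟨f + -g, ?_⟩
  rw [sub_eq_add_neg, map_add, map_neg]
  exact hf.add hg.neg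

theorem index_lt (j : ℕ) : (1 / 2 - 1 / ((j : ℝ) + 1)) < 1 / 2 := by
  have : (0 : ℝ) < 1 / ((j : ℝ) + 1) := by positivity
  linarith

theorem div_one_add_le_one {x : ℝ} (hx : 0 ≤ x) : x / (1 + x) ≤ 1 := by
  rw [div_le_one (by linarith)]
  linarith

theorem div_one_add_mono {x y z : ℝ} (hx : 0 ≤ x) (hy : 0 ≤ y) (hz : 0 ≤ z) (h : z ≤ x + y) :
    z / (1 + z) ≤ x / (1 + x) + y / (1 + y) := by
  rw [div_add_div _ _ (by positivity) (by positivity), div_le_div_iff₀ (by positivity)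
    (by positivity)]
  nlinarith [mul_nonneg hx hy, mul_nonneg (mul_nonneg hx hy) hz]

theorem summable_hdist (u v : HalfLoc) :
    Summable fun i : ℕ × ℕ => (1 / 2 : ℝ) ^ ((i.1 + 1) + (i.2 + 1)) *
      (pNorm (i.1 + 1) (1 / 2 - 1 / (i.2 + 1)) (u.val - v.val) /
        (1 + pNorm (i.1 + 1) (1 / 2 - 1 / (i.2 + 1)) (u.val - v.val))) := by
  have h : Summable fun i : ℕ × ℕ => (1 / 2 : ℝ) ^ i.1 * (1 / 2 : ℝ) ^ i.2 :=
    summable_geometric_two.mul_of_nonneg summable_geometric_two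
      (fun _ => by positivity) (fun _ => by positivity)
  refine Summable.of_nonneg_of_le (fun i => ?_) (fun i => ?_) h
  · have := pNorm_nonneg (i.1 + 1) (1 / 2 - 1 / (i.2 + 1)) (u.val - v.val)
    positivity
  · rw [← pow_add]
    calc _ ≤ (1 / 2 : ℝ) ^ ((i.1 + 1) + (i.2 + 1)) * 1 := by
            gcongr
            exact div_one_add_le_one (pNorm_nonneg _ _ _)
      _ ≤ _ := by
            rw [mul_one]
            exact pow_le_pow_of_le_one (by norm_num) (by norm_num) (by omega)

/-- `H^{1/2-}_loc` carries the topology of `d`. -/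
instance : PseudoMetricSpace HalfLoc where
  dist := hdist
  dist_self u := by simp [hdist, pNorm_zero]
  dist_comm u v := by
    refine tsum_congr fun i => ?_
    obtain ⟨g, hg⟩ := exists_rep_sub v u (index_lt i.2)
    rw [← neg_sub v.val u.val, pNorm_neg hg]
  dist_triangle u v w := by
    rw [hdist, hdist, hdist, ← (summable_hdist u v).tsum_add (summable_hdist v w)]
    refine (summable_hdist u w).tsum_le_tsum (fun i => ?_)
      ((summable_hdist u v).add (summable_hdist v w))
    rw [← mul_add]
    gcongr
    obtain ⟨f, hf⟩ := exists_rep_sub u v (index_lt i.2)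
    obtain ⟨g, hg⟩ := exists_rep_sub v w (index_lt i.2)
    refine div_one_add_mono (pNorm_nonneg _ _ _) (pNorm_nonneg _ _ _) (pNorm_nonneg _ _ _) ?_
    rw [← sub_add_sub_cancel u.val v.val w.val]
    exact pNorm_add_le hf hg

/-- The topological `σ`-algebra of `H^{1/2-}_loc`. -/
instance : MeasurableSpace HalfLoc := borel HalfLoc

instance : BorelSpace HalfLoc := ⟨rfl⟩

end HalfLoc

/-- `L(t)⁻¹(A) = {u ∈ H^{1/2-}_loc : L(t) u ∈ A}`. -/
def flowPreimage (t : ℝ) (A : Set HalfLoc) : Set HalfLoc :=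
  {u | ∃ v ∈ A, v.val = linFlow t u.val}

/-! ### The Gaussian field -/

/-- The centred circular complex Gaussian law with `E |Z|² = v`. -/
def complexGaussian (v : ℝ≥0) : Measure ℂ :=
  ((gaussianReal 0 (v / 2)).prod (gaussianReal 0 (v / 2))).map
    fun p : ℝ × ℝ => (p.1 : ℂ) + p.2 * Complex.I

/-- `W` is a two-sided complex Brownian motion, normalised by `E |W_t - W_s|² = |t - s|`. The initial
value `W_0` is left free, as only the increments matter. -/
structure IsComplexBrownian {Ω : Type*} [MeasurableSpace Ω] (W : ℝ → Ω → ℂ) (P : Measure Ω) :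
    Prop where
  measurable : ∀ t, Measurable (W t)
  indep : HasIndepIncrements W P
  law : ∀ s t, HasLaw (W t - W s) (complexGaussian (nndist s t)) P
  cont : ∀ᵐ ω ∂P, Continuous fun t => W t ω

/-- The tempered distribution `x ↦ exp (i n x)`. -/
def planeWave (n : ℝ) : 𝓢'(ℝ, ℂ) := 𝓕⁻ (TemperedDistribution.delta (n / (2 * Real.pi)))

theorem planeWave_apply (n : ℝ) (ψ : 𝓢(ℝ, ℂ)) :
    planeWave n ψ = ∫ x : ℝ, Complex.exp (Complex.I * n * x) * ψ x := by
  rw [planeWave, TemperedDistribution.fourierInv_apply, TemperedDistribution.delta_apply,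
    SchwartzMap.fourierInv_coe, Real.fourierInv_eq']
  refine integral_congr_ae (Eventually.of_forall fun x => ?_)
  simp only [smul_eq_mul, RCLike.inner_apply, conj_trivial]
  congr 2
  push_cast
  field_simp

theorem besselD_planeWave (s n : ℝ) :
    besselD s (planeWave n) = (((1 + n ^ 2) ^ (s / 2) : ℝ) : ℂ) • planeWave n := by
  ext ψ
  have hn : besselSymbol s (n / (2 * Real.pi)) = (((1 + n ^ 2) ^ (s / 2) : ℝ) : ℂ) := by
    rw [besselSymbol, mul_div_cancel₀ n (by positivity)]
  change (𝓕⁻ (𝓕 (SchwartzMap.smulLeftCLM ℂ (besselSymbol s) (𝓕⁻ ψ)))) (n / (2 * Real.pi)) =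
    (((1 + n ^ 2) ^ (s / 2) : ℝ) : ℂ) • (𝓕⁻ ψ) (n / (2 * Real.pi))
  rw [FourierTransform.fourierInv_fourier_eq,
    SchwartzMap.smulLeftCLM_apply_apply (besselSymbol_hasTemperateGrowth s), hn]

/-- `D^s φ_{N,R}(ω, x)`, where `φ_{N,R}(ω, x)` is the sum over `-NR ≤ k < NR` of
`(W_{(k+1)/N} - W_{k/N}) (1 + k²/N²)^{-1/2} exp (i k x / N)`; on the wave `exp (i k x / N)` the
operator `D^s` is the factor `(1 + k²/N²)^{s/2}` (`besselD_planeWave`). -/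
def approxField {Ω : Type*} (W : ℝ → Ω → ℂ) (s : ℝ) (N R : ℕ) (ω : Ω) (x : ℝ) : ℂ :=
  ∑ k ∈ Finset.Ico (-((N : ℤ) * R)) ((N : ℤ) * R),
    (W (((k : ℝ) + 1) / N) ω - W ((k : ℝ) / N) ω) *
      (((1 + ((k : ℝ) / N) ^ 2) ^ ((s - 1) / 2) : ℝ) : ℂ) *
        Complex.exp (Complex.I * ((k : ℝ) / N : ℝ) * x)

/-- `φ` is the field `∫ (1 + n²)^{-1/2} exp (i n x) dW_n` with values in `H^{1/2-}_loc`: for every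
`s < 1/2`, `D^s φ` is the limit of `D^s φ_{2^k,k}` in the norm
`ess sup_x (1 + x²)^{-1/2} (E |·|²)^{1/2}`. -/
structure IsGaussianField {Ω : Type*} [MeasurableSpace Ω] (W : ℝ → Ω → ℂ) (P : Measure Ω)
    (φ : Ω → HalfLoc) : Prop where
  measurable : Measurable φ
  limit : ∀ s : ℝ, s < 1 / 2 → ∃ G : Ω → ℝ → ℂ, Measurable (Function.uncurry G) ∧
    (∀ᵐ ω ∂P, IsL2LocRep (besselD s (φ ω).val) (G ω)) ∧
    Tendsto (fun k : ℕ => essSup (fun x : ℝ => ENNReal.ofReal ((1 + x ^ 2) ^ (-(1 / 2) : ℝ)) *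
      eLpNorm (fun ω => G ω x - approxField W s (2 ^ k) k ω x) 2 P) volume) atTop (𝓝 0)

end KleinGordon

end

open MeasureTheory ProbabilityTheory Filter Topology
open scoped SchwartzMap ENNReal NNReal FourierTransform

noncomputable section

namespace KleinGordon

/-! ### Test functions of compact support -/

/-! The field `φ_{N,R}` is a finite sum of plane waves whose coefficients are independent circular
complex Gaussians. Each plane wave is an eigenvector of `L(t)` with an eigenvalue of modulus one, so
`L(t)` only rotates the coefficients, and their joint law does not change (`map_incrs_rotate`,
`map_flow_stepField`). Invariance of `μ` follows by passing to an almost sure limit on both sides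
(`map_eq_of_ae_tendsto`).

The difficulty is this passage to the limit: `L(t)` is not local, so convergence in `L²_loc` alone
gives no control of the images. The argument runs in the weighted space `w L²` with `w(x) = 1 + i
x`. Since multiplication by `x` is a derivative in frequency, `m(D) w - w m(D) = (2π)⁻¹ m'(D)`, so a
multiplier bounded together with its derivative acts boundedly on `w L²`
(`IsMultiplier.fourierMultiplier_wtDist`). This covers `L(t)` and the operators `D^s` with `s ≤ 0`.
The elements all of whose derivatives `D^s u`, `s < 1/2`, lie in `w L²` form a Borel set `tame`; on
it `L(t)` is measurable and respects weighted convergence.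

The approximations do converge there. On a common dyadic grid the difference of two of them is a sum
over independent increments, and Pythagoras turns its second moment into a Riemann sum, bounded by
`(1 + x²)^{1/4}` times an error tending to `0` (`lintegral_approxField_sub_le`). The condition `s <
1/2` is integrability of `(1 + n²)^{s-1}`. The growth in `x` is integrable against `|w|⁻²` and is
dominated by the squared weight of the required norm. A subsequence therefore converges almost
surely in `w L²` for all the exponents `expo l` at once, which defines `φ`; uniqueness only needs
the exponent `s = 0`. -/

theorem iteratedDeriv_one_sub_bump_bound (χ : ContDiffBump (0 : ℝ)) (i : ℕ) :
    ∃ B : ℝ, 0 ≤ B ∧ ∀ x, ‖iteratedDeriv i (fun y => 1 - χ y) x‖ ≤ B := by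
  have hc : HasCompactSupport (iteratedFDeriv ℝ i χ) := χ.hasCompactSupport.iteratedFDeriv i
  have hcont : Continuous (iteratedFDeriv ℝ i χ) :=
    (χ.contDiff (n := ⊤)).continuous_iteratedFDeriv (by exact_mod_cast le_top)
  obtain ⟨C, hC⟩ := hc.exists_bound_of_continuous hcont
  have hC0 : 0 ≤ C := (norm_nonneg _).trans (hC 0)
  refine ⟨1 + C, by positivity, fun x => ?_⟩
  have h1 : iteratedDeriv i (fun y => 1 - χ y) x =
      iteratedDeriv i (fun _ => (1 : ℝ)) x - iteratedDeriv i χ x :=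
    iteratedDeriv_fun_sub contDiffAt_const (χ.contDiff (n := i)).contDiffAt
  rw [h1]
  refine (norm_sub_le _ _).trans (add_le_add ?_ ?_)
  · rw [iteratedDeriv_const]
    split_ifs <;> simp
  · rw [← norm_iteratedFDeriv_eq_norm_iteratedDeriv]
    exact hC x

/-- The function `1 - χ(y / (n+1))` vanishes on `|y| < n + 1`, and elsewhere `|x| / (n+1) ≥ 1`. Thus
one power of `x` buys the decay `1/(n+1)`. -/
theorem norm_iteratedDeriv_one_sub_bump_scaled_le (χ : ContDiffBump (0 : ℝ)) (hχ : χ.rIn = 1)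
    (i : ℕ) : ∃ B : ℝ, 0 ≤ B ∧ ∀ (n : ℕ) (x : ℝ),
      ‖iteratedDeriv i (fun y => 1 - χ ((n + 1 : ℝ)⁻¹ * y)) x‖ ≤ B * |x| / (n + 1) := by
  obtain ⟨B, hB, h⟩ := iteratedDeriv_one_sub_bump_bound χ i
  refine ⟨B, hB, fun n x => ?_⟩
  have hn : (0 : ℝ) < n + 1 := by positivity
  have hd := iteratedDeriv_comp_const_mul (n := i) (f := fun y => 1 - χ y)
    (contDiff_const.sub χ.contDiff) (n + 1 : ℝ)⁻¹
  rcases lt_or_ge |x| (n + 1) with hx | hx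
  · have : (fun y => 1 - χ ((n + 1 : ℝ)⁻¹ * y)) =ᶠ[𝓝 x] fun _ => (0 : ℝ) := by
      have ho : IsOpen {y : ℝ | |y| < n + 1} := isOpen_lt continuous_abs continuous_const
      filter_upwards [ho.mem_nhds hx] with y hy
      rw [χ.one_of_mem_closedBall, sub_self]
      rw [mem_closedBall_zero_iff, hχ, norm_mul, norm_inv, Real.norm_of_nonneg hn.le,
        Real.norm_eq_abs, inv_mul_le_one₀ hn]
      exact le_of_lt hy
    rw [this.iteratedDeriv_eq]
    rw [iteratedDeriv_const]
    simp only [ite_self, norm_zero]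
    positivity
  · rw [hd]
    calc ‖(n + 1 : ℝ)⁻¹ ^ i * iteratedDeriv i (fun y => 1 - χ y) ((n + 1 : ℝ)⁻¹ * x)‖
        ≤ 1 * B := by
          rw [norm_mul]
          gcongr
          · rw [norm_pow, norm_inv, Real.norm_of_nonneg hn.le]
            exact pow_le_one₀ (by positivity) (inv_le_one_of_one_le₀ (by simp))
          · exact h _
      _ = B * (n + 1) / (n + 1) := by field_simp
      _ ≤ B * |x| / (n + 1) := by gcongr

/-- The cut-off functions `χ(x / (n+1)) ψ(x)` converge to `ψ` in the Schwartz space. -/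
theorem exists_tendsto_of_hasCompactSupport (ψ : 𝓢(ℝ, ℂ)) :
    ∃ η : ℕ → 𝓢(ℝ, ℂ), (∀ n, HasCompactSupport (η n)) ∧ Tendsto η atTop (𝓝 ψ) := by
  let χ : ContDiffBump (0 : ℝ) := ⟨1, 2, one_pos, one_lt_two⟩
  let c : ℕ → ℝ → ℝ := fun n y => χ ((n + 1 : ℝ)⁻¹ * y)
  have hcs : ∀ n, ContDiff ℝ (⊤ : ℕ∞) (c n) := fun n =>
    χ.contDiff.comp (contDiff_const.mul contDiff_id)
  have hcc : ∀ n, HasCompactSupport (c n) := fun n => by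
    have hn : (n + 1 : ℝ)⁻¹ ≠ 0 := by positivity
    exact χ.hasCompactSupport.comp_homeomorph (Homeomorph.mulLeft₀ _ hn)
  have hct : ∀ n, (c n).HasTemperateGrowth := fun n => (hcc n).hasTemperateGrowth (hcs n)
  refine ⟨fun n => SchwartzMap.smulLeftCLM ℂ (c n) ψ, fun n => ?_, ?_⟩
  · exact (hcc n).mono' ((subset_tsupport _).trans
      ((SchwartzMap.tsupport_smulLeftCLM_subset (c n) ψ).trans Set.inter_subset_right))
  rw [(schwartz_withSeminorms ℝ ℝ ℂ).tendsto_nhds]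
  rintro ⟨k, m⟩ ε hε
  choose B hB0 hB using norm_iteratedDeriv_one_sub_bump_scaled_le χ rfl
  -- The seminorm of order `k + 1` instead of `k` absorbs the factor `|x|` of the bound for `1 - χ`.
  set S : ℝ := ∑ i ∈ Finset.range (m + 1), (m.choose i) * B i *
    SchwartzMap.seminorm ℝ (k + 1) (m - i) ψ with hS
  have hS0 : 0 ≤ S := Finset.sum_nonneg fun i _ => by
    have := hB0 i
    have := apply_nonneg (SchwartzMap.seminorm ℝ (k + 1) (m - i)) ψ
    positivity
  have key : ∀ n : ℕ, SchwartzMap.seminorm ℝ k m (SchwartzMap.smulLeftCLM ℂ (c n) ψ - ψ) ≤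
      S / (n + 1) := by
    intro n
    refine SchwartzMap.seminorm_le_bound ℝ k m _ (by positivity) fun x => ?_
    have hfun : ⇑(SchwartzMap.smulLeftCLM ℂ (c n) ψ - ψ) = -fun y => (1 - c n y) • ψ y := by
      ext y
      simp [SchwartzMap.smulLeftCLM_apply_apply (hct n), sub_smul]
    rw [hfun, iteratedFDeriv_neg_apply, norm_neg]
    have hle := norm_iteratedFDeriv_smul_le (N := (⊤ : ℕ∞)) (contDiff_const.sub (hcs n))
      (ψ.smooth ⊤) x (n := m) (f := fun y => 1 - c n y) (by exact_mod_cast le_top)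
    calc ‖x‖ ^ k * ‖iteratedFDeriv ℝ m (fun y => (1 - c n y) • ψ y) x‖
        ≤ ‖x‖ ^ k * ∑ i ∈ Finset.range (m + 1), (m.choose i) *
          ‖iteratedFDeriv ℝ i (fun y => 1 - c n y) x‖ * ‖iteratedFDeriv ℝ (m - i) ψ x‖ := by
          gcongr
      _ ≤ ‖x‖ ^ k * ∑ i ∈ Finset.range (m + 1), (m.choose i) *
          (B i * |x| / (n + 1)) * ‖iteratedFDeriv ℝ (m - i) ψ x‖ := by
          gcongr with i
          rw [norm_iteratedFDeriv_eq_norm_iteratedDeriv]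
          exact hB i n x
      _ = ∑ i ∈ Finset.range (m + 1), (m.choose i) * B i *
          (‖x‖ ^ (k + 1) * ‖iteratedFDeriv ℝ (m - i) ψ x‖) / (n + 1) := by
          rw [Finset.mul_sum]
          refine Finset.sum_congr rfl fun i _ => ?_
          rw [Real.norm_eq_abs]
          ring
      _ ≤ S / (n + 1) := by
          rw [hS, Finset.sum_div]
          gcongr with i
          · exact mul_nonneg (by positivity) (hB0 i)
          · exact SchwartzMap.le_seminorm ℝ (k + 1) (m - i) ψ x
  have hlim : Tendsto (fun n : ℕ => S / ((n : ℝ) + 1)) atTop (𝓝 0) :=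
    by simpa [div_eq_mul_inv] using (tendsto_one_div_add_atTop_nhds_zero_nat (𝕜 := ℝ)).const_mul S
  filter_upwards [hlim.eventually_lt_const hε] with n hn
  exact (key n).trans_lt hn

/-- Tempered distributions are determined by their values on test functions of compact support. -/
theorem ext_of_hasCompactSupport {S T : 𝓢'(ℝ, ℂ)}
    (h : ∀ ψ : 𝓢(ℝ, ℂ), HasCompactSupport ψ → S ψ = T ψ) : S = T := by
  ext ψ
  obtain ⟨η, hη, hlim⟩ := exists_tendsto_of_hasCompactSupport ψ
  have hS := ((ContinuousLinearMap.continuous S).tendsto ψ).comp hlim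
  have hT := ((ContinuousLinearMap.continuous T).tendsto ψ).comp hlim
  refine tendsto_nhds_unique hS (hT.congr fun n => ?_)
  exact (h (η n) (hη n)).symm

/-! ### The weighted space `w L²` with `w(x) = 1 + i x` -/

/-- The Hilbert space `L²(ℝ)`. -/
abbrev L2 : Type := Lp ℂ 2 (volume : Measure ℝ)

/-- The weight `w(x) = 1 + i x`, of modulus `(1 + x²)^{1/2}`. -/
def wt (x : ℝ) : ℂ := 1 + Complex.I * x

theorem wt_ne_zero (x : ℝ) : wt x ≠ 0 := by
  intro h
  have := congrArg Complex.re h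
  simp [wt] at this

theorem norm_wt_sq (x : ℝ) : ‖wt x‖ ^ 2 = 1 + x ^ 2 := by
  rw [← Complex.normSq_eq_norm_sq, wt, Complex.normSq_apply]
  simp
  ring

theorem one_le_norm_wt (x : ℝ) : 1 ≤ ‖wt x‖ := by
  nlinarith [norm_wt_sq x, norm_nonneg (wt x), sq_nonneg x]

theorem norm_wt_inv_le (x : ℝ) : ‖(wt x)⁻¹‖ ≤ 1 := by
  rw [norm_inv]
  exact inv_le_one_of_one_le₀ (one_le_norm_wt x)

theorem wt_hasTemperateGrowth : wt.HasTemperateGrowth := by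
  have h := Function.Complex.hasTemperateGrowth_ofReal
  have : wt = (fun _ => (1 : ℂ)) + (fun _ => Complex.I) * Complex.ofReal := by
    ext x
    simp [wt]
  rw [this]
  exact (Function.HasTemperateGrowth.const 1).add ((Function.HasTemperateGrowth.const Complex.I).mul h)

theorem continuous_wt : Continuous wt := wt_hasTemperateGrowth.1.continuous

theorem memLp_wt_inv : MemLp (fun x => (wt x)⁻¹) ∞ (volume : Measure ℝ) :=
  memLp_top_of_bound (continuous_wt.inv₀ wt_ne_zero).aestronglyMeasurable 1
    (Eventually.of_forall norm_wt_inv_le)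

/-- Multiplication by a bounded function on `L²(ℝ)`. -/
def mulL2 {f : ℝ → ℂ} (hf : MemLp f ∞ (volume : Measure ℝ)) : L2 →L[ℂ] L2 :=
  (ContinuousLinearMap.mul ℂ ℂ).holderL volume ∞ 2 2 (hf.toLp f)

theorem coeFn_mulL2 {f : ℝ → ℂ} (hf : MemLp f ∞ (volume : Measure ℝ)) (g : L2) :
    mulL2 hf g =ᵐ[volume] fun x => f x * g x := by
  have h := (ContinuousLinearMap.mul ℂ ℂ).coeFn_holder (r := 2) (hf.toLp f) g
  filter_upwards [h, hf.coeFn_toLp] with x h1 h2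
  rw [← h2]
  exact h1

theorem mulL2_toTemperedDistribution {f : ℝ → ℂ} (hf : MemLp f ∞ (volume : Measure ℝ))
    (hf' : f.HasTemperateGrowth) (g : L2) :
    (Lp.toTemperedDistribution (mulL2 hf g) : 𝓢'(ℝ, ℂ)) =
      TemperedDistribution.smulLeftCLM ℂ f (Lp.toTemperedDistribution g) := by
  ext ψ
  simp only [Lp.toTemperedDistribution_apply, TemperedDistribution.smulLeftCLM_apply_apply]
  refine integral_congr_ae ?_
  filter_upwards [coeFn_mulL2 hf g] with x hx
  rw [hx, SchwartzMap.smulLeftCLM_apply_apply hf']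
  simp only [smul_eq_mul]
  ring

/-- The tempered distribution `w g`, for `g` in `L²(ℝ)`. -/
def wtDist : L2 →L[ℂ] 𝓢'(ℝ, ℂ) :=
  TemperedDistribution.smulLeftCLM ℂ wt ∘L Lp.toTemperedDistributionCLM ℂ volume 2

theorem wtDist_eq (g : L2) :
    wtDist g = TemperedDistribution.smulLeftCLM ℂ wt (Lp.toTemperedDistribution g) := rfl

theorem wtDist_apply (g : L2) (ψ : 𝓢(ℝ, ℂ)) : wtDist g ψ = ∫ x, ψ x * (wt x * g x) := by
  rw [wtDist_eq, TemperedDistribution.smulLeftCLM_apply_apply, Lp.toTemperedDistribution_apply]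
  refine integral_congr_ae (Eventually.of_forall fun x => ?_)
  simp only [SchwartzMap.smulLeftCLM_apply_apply wt_hasTemperateGrowth, smul_eq_mul]
  ring

/-- The bounded multiplier with symbol `m` on `L²(ℝ)`. -/
def multL2 {m : ℝ → ℂ} (hm : MemLp m ∞ (volume : Measure ℝ)) : L2 →L[ℂ] L2 :=
  ((Lp.fourierTransformₗᵢ ℝ ℂ).symm.toContinuousLinearEquiv : L2 →L[ℂ] L2) ∘L mulL2 hm ∘L
    ((Lp.fourierTransformₗᵢ ℝ ℂ).toContinuousLinearEquiv : L2 →L[ℂ] L2)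

theorem multL2_eq {m : ℝ → ℂ} (hm : MemLp m ∞ (volume : Measure ℝ)) (g : L2) :
    multL2 hm g = 𝓕⁻ (mulL2 hm (𝓕 g)) := rfl

theorem fourierMultiplier_toTemperedDistribution {m : ℝ → ℂ}
    (hm : MemLp m ∞ (volume : Measure ℝ)) (hm' : m.HasTemperateGrowth) (g : L2) :
    TemperedDistribution.fourierMultiplierCLM ℂ m (Lp.toTemperedDistribution g) =
      Lp.toTemperedDistribution (multL2 hm g) := by
  rw [multL2_eq, ← Lp.fourierInv_toTemperedDistribution_eq, mulL2_toTemperedDistribution hm hm',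
    ← Lp.fourier_toTemperedDistribution_eq, TemperedDistribution.fourierMultiplierCLM_apply]

theorem hasTemperateGrowth_deriv {m : ℝ → ℂ} (hm : m.HasTemperateGrowth) :
    (deriv m).HasTemperateGrowth := by
  refine ⟨hm.1.deriv' , fun n => ?_⟩
  obtain ⟨k, C, h⟩ := hm.2 (n + 1)
  refine ⟨k, C, fun x => ?_⟩
  rw [norm_iteratedFDeriv_eq_norm_iteratedDeriv, ← iteratedDeriv_succ',
    ← norm_iteratedFDeriv_eq_norm_iteratedDeriv]
  exact h x

open LineDeriv in
/-- The commutator of a Fourier multiplier with the multiplication by `w`. -/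
theorem wt_mul_fourier_mul_fourierInv {m : ℝ → ℂ} (hm : m.HasTemperateGrowth) (ψ : 𝓢(ℝ, ℂ)) :
    SchwartzMap.smulLeftCLM ℂ wt (𝓕 (SchwartzMap.smulLeftCLM ℂ m (𝓕⁻ ψ))) =
      𝓕 (SchwartzMap.smulLeftCLM ℂ m (𝓕⁻ (SchwartzMap.smulLeftCLM ℂ wt ψ))) +
        (2 * Real.pi : ℂ)⁻¹ • 𝓕 (SchwartzMap.smulLeftCLM ℂ (deriv m) (𝓕⁻ ψ)) := by
  have hx : (inner ℝ · (1 : ℝ) : ℝ → ℝ).HasTemperateGrowth := by fun_prop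
  have hpi : (2 * Real.pi * Complex.I : ℂ) ≠ 0 := Complex.two_pi_I_ne_zero
  have hw : ∀ η : 𝓢(ℝ, ℂ), SchwartzMap.smulLeftCLM ℂ wt η =
      η + Complex.I • SchwartzMap.smulLeftCLM ℂ (inner ℝ · (1 : ℝ) : ℝ → ℝ) η := by
    intro η
    ext x
    rw [SchwartzMap.smulLeftCLM_apply_apply wt_hasTemperateGrowth, add_apply, smul_apply,
      SchwartzMap.smulLeftCLM_apply_apply hx]
    simp [wt]
    ring
  have hprod : ∂_{(1 : ℝ)} (SchwartzMap.smulLeftCLM ℂ m (𝓕⁻ ψ)) =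
      SchwartzMap.smulLeftCLM ℂ (deriv m) (𝓕⁻ ψ) +
        SchwartzMap.smulLeftCLM ℂ m (∂_{(1 : ℝ)} (𝓕⁻ ψ)) := by
    ext x
    have hd := ((hm.1.differentiable (by simp)) x).hasDerivAt.mul
      (SchwartzMap.hasDerivAt (𝓕⁻ ψ) x)
    have hfun : ⇑(SchwartzMap.smulLeftCLM ℂ m (𝓕⁻ ψ)) = m * ⇑(𝓕⁻ ψ : 𝓢(ℝ, ℂ)) := by
      ext y
      simp [SchwartzMap.smulLeftCLM_apply_apply hm]
    simp only [add_apply, SchwartzMap.smulLeftCLM_apply_apply hm,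
      SchwartzMap.smulLeftCLM_apply_apply (hasTemperateGrowth_deriv hm), smul_eq_mul,
      SchwartzMap.lineDerivOp_apply_eq_fderiv, fderiv_apply_one_eq_deriv, hfun]
    exact hd.deriv
  -- Both rules exchange `∂` with multiplication by `2πi x`; the product rule between them leaves
  -- the extra term with `m'`. The factor `i` of `w` then cancels that of `2πi`.
  have h1 := SchwartzMap.fourier_lineDerivOp_eq (SchwartzMap.smulLeftCLM ℂ m (𝓕⁻ ψ)) (1 : ℝ)
  have h2 := SchwartzMap.lineDerivOp_fourierInv_eq ψ (1 : ℝ)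
  rw [hprod, h2] at h1
  have h3 : SchwartzMap.smulLeftCLM ℂ (inner ℝ · (1 : ℝ) : ℝ → ℝ)
      (𝓕 (SchwartzMap.smulLeftCLM ℂ m (𝓕⁻ ψ))) =
      (2 * Real.pi * Complex.I : ℂ)⁻¹ • 𝓕 (SchwartzMap.smulLeftCLM ℂ (deriv m) (𝓕⁻ ψ)) +
      𝓕 (SchwartzMap.smulLeftCLM ℂ m (𝓕⁻
        (SchwartzMap.smulLeftCLM ℂ (inner ℝ · (1 : ℝ) : ℝ → ℝ) ψ))) := by
    rw [eq_comm, ← smul_right_inj hpi, ← h1]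
    simp only [FourierTransform.fourier_add, FourierTransform.fourierInv_smul, map_smul,
      FourierTransform.fourier_smul, smul_add, smul_smul, mul_inv_cancel₀ hpi, one_smul]
  rw [hw, h3, hw ψ]
  simp only [FourierTransform.fourierInv_add, map_add, FourierTransform.fourier_add,
    FourierTransform.fourierInv_smul, map_smul, FourierTransform.fourier_smul, smul_add, smul_smul]
  have : Complex.I * (2 * Real.pi * Complex.I : ℂ)⁻¹ = (2 * Real.pi : ℂ)⁻¹ := by
    field_simp
  rw [this]
  abel

/-- Transpose of the commutator identity on test functions. -/
theorem fourierMultiplier_smul_wt {m : ℝ → ℂ} (hm : m.HasTemperateGrowth) (T : 𝓢'(ℝ, ℂ)) :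
    TemperedDistribution.fourierMultiplierCLM ℂ m (TemperedDistribution.smulLeftCLM ℂ wt T) =
      TemperedDistribution.smulLeftCLM ℂ wt (TemperedDistribution.fourierMultiplierCLM ℂ m T) +
        (2 * Real.pi : ℂ)⁻¹ • TemperedDistribution.fourierMultiplierCLM ℂ (deriv m) T := by
  ext ψ
  change T (SchwartzMap.smulLeftCLM ℂ wt (𝓕 (SchwartzMap.smulLeftCLM ℂ m (𝓕⁻ ψ)))) =
    T (𝓕 (SchwartzMap.smulLeftCLM ℂ m (𝓕⁻ (SchwartzMap.smulLeftCLM ℂ wt ψ)))) +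
      (2 * Real.pi : ℂ)⁻¹ • T (𝓕 (SchwartzMap.smulLeftCLM ℂ (deriv m) (𝓕⁻ ψ)))
  rw [wt_mul_fourier_mul_fourierInv hm, map_add, map_smul]

/-! ### Multipliers acting on the weighted space -/

/-- A symbol of temperate growth that is bounded with its derivative. -/
structure IsMultiplier (m : ℝ → ℂ) : Prop where
  temperate : m.HasTemperateGrowth
  bound : ∃ C, ∀ x, ‖m x‖ ≤ C
  bound_deriv : ∃ C, ∀ x, ‖deriv m x‖ ≤ C

theorem IsMultiplier.memLp {m : ℝ → ℂ} (h : IsMultiplier m) :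
    MemLp m ∞ (volume : Measure ℝ) :=
  memLp_top_of_bound h.temperate.1.continuous.aestronglyMeasurable h.bound.choose
    (Eventually.of_forall h.bound.choose_spec)

theorem IsMultiplier.memLp_deriv {m : ℝ → ℂ} (h : IsMultiplier m) :
    MemLp (deriv m) ∞ (volume : Measure ℝ) :=
  memLp_top_of_bound (hasTemperateGrowth_deriv h.temperate).1.continuous.aestronglyMeasurable
    h.bound_deriv.choose (Eventually.of_forall h.bound_deriv.choose_spec)

/-- The operator `w⁻¹ m(D) w` on `L²(ℝ)`. -/
def IsMultiplier.conj {m : ℝ → ℂ} (h : IsMultiplier m) : L2 →L[ℂ] L2 :=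
  multL2 h.memLp + (2 * Real.pi : ℂ)⁻¹ • (mulL2 memLp_wt_inv ∘L multL2 h.memLp_deriv)

/-- Since `w⁻¹` is bounded, `L²` is contained in `w L²`; this places the commutator term in `w L²`.
-/
theorem wtDist_mulL2_wt_inv (g : L2) :
    wtDist (mulL2 memLp_wt_inv g) = Lp.toTemperedDistribution g := by
  ext ψ
  rw [wtDist_apply, Lp.toTemperedDistribution_apply]
  refine integral_congr_ae ?_
  filter_upwards [coeFn_mulL2 memLp_wt_inv g] with x hx
  rw [hx, mul_inv_cancel_left₀ (wt_ne_zero x), smul_eq_mul]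

/-- A multiplier that is bounded with its derivative preserves `w L²`. -/
theorem IsMultiplier.fourierMultiplier_wtDist {m : ℝ → ℂ} (h : IsMultiplier m) (g : L2) :
    TemperedDistribution.fourierMultiplierCLM ℂ m (wtDist g) = wtDist (h.conj g) := by
  rw [wtDist_eq, fourierMultiplier_smul_wt h.temperate,
    fourierMultiplier_toTemperedDistribution h.memLp h.temperate,
    fourierMultiplier_toTemperedDistribution h.memLp_deriv (hasTemperateGrowth_deriv h.temperate),
    ← wtDist_eq, ← wtDist_mulL2_wt_inv (multL2 h.memLp_deriv g), ← map_smul, ← map_add]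
  rfl

/-- With `y = 2πξ`, the derivative is of size `|y| (1 + y²)^{s/2-1} ≤ (1 + y²)^{(s-1)/2}`. The
condition `s ≤ 0` is what bounds the symbol itself. -/
theorem isMultiplier_besselSymbol {s : ℝ} (hs : s ≤ 0) : IsMultiplier (besselSymbol s) := by
  have hone : ∀ y : ℝ, 1 ≤ 1 + y ^ 2 := fun y => by nlinarith [sq_nonneg y]
  refine ⟨besselSymbol_hasTemperateGrowth s, ⟨1, fun x => ?_⟩, ⟨2 * Real.pi * |s|, fun x => ?_⟩⟩
  · rw [besselSymbol, Complex.norm_real, Real.norm_of_nonneg (by positivity)]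
    exact Real.rpow_le_one_of_one_le_of_nonpos (hone _) (by linarith)
  · have h0 : HasDerivAt (fun ξ : ℝ => 1 + (2 * Real.pi * ξ) ^ 2)
        (2 * (2 * Real.pi * x) * (2 * Real.pi)) x := by
      have := (((hasDerivAt_id x).const_mul (2 * Real.pi)).pow 2).const_add 1
      simpa using this
    have h1 := (h0.rpow_const (p := s / 2) (Or.inl (by positivity))).ofReal_comp
    have h2 : deriv (besselSymbol s) x = _ := h1.deriv
    rw [h2, Complex.norm_real]
    set y := 2 * Real.pi * x
    have hy : |y| ≤ (1 + y ^ 2) ^ (1 / 2 : ℝ) := by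
      rw [← Real.sqrt_eq_rpow]
      exact Real.abs_le_sqrt (by linarith)
    have h3 : |y| * (1 + y ^ 2) ^ (s / 2 - 1) ≤ 1 := by
      calc |y| * (1 + y ^ 2) ^ (s / 2 - 1)
          ≤ (1 + y ^ 2) ^ (1 / 2 : ℝ) * (1 + y ^ 2) ^ (s / 2 - 1) := by gcongr
        _ = (1 + y ^ 2) ^ (1 / 2 + (s / 2 - 1) : ℝ) := (Real.rpow_add (by positivity) _ _).symm
        _ ≤ 1 := Real.rpow_le_one_of_one_le_of_nonpos (hone _) (by linarith)
    rw [Real.norm_eq_abs]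
    calc |2 * y * (2 * Real.pi) * (s / 2) * (1 + y ^ 2) ^ (s / 2 - 1)|
        = 2 * Real.pi * |s| * (|y| * (1 + y ^ 2) ^ (s / 2 - 1)) := by
          simp only [abs_mul, abs_div, abs_of_pos Real.pi_pos, abs_two]
          rw [abs_of_nonneg (a := (1 + y ^ 2) ^ (s / 2 - 1)) (by positivity)]
          ring
      _ ≤ 2 * Real.pi * |s| * 1 := by gcongr
      _ = _ := mul_one _

/-- The symbol has modulus one, and its derivative is bounded because the group velocity `n / √(1 +
n²)` has modulus at most `1`. -/
theorem isMultiplier_flowSymbol (t : ℝ) : IsMultiplier (flowSymbol t) := by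
  have hnorm : ∀ r : ℝ, ‖Complex.exp (-(Complex.I * r))‖ = 1 := fun r => by
    have := Complex.norm_exp_ofReal_mul_I (-r)
    rw [← this]
    congr 2
    push_cast
    ring
  refine ⟨flowSymbol_hasTemperateGrowth t, ⟨1, fun x => (hnorm _).le⟩,
    ⟨|t| * (2 * Real.pi), fun x => ?_⟩⟩
  have h0 : HasDerivAt (fun ξ : ℝ => 1 + (2 * Real.pi * ξ) ^ 2)
      (2 * (2 * Real.pi * x) * (2 * Real.pi)) x := by
    have := (((hasDerivAt_id x).const_mul (2 * Real.pi)).pow 2).const_add 1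
    simpa using this
  have h1 := ((h0.sqrt (by positivity)).const_mul t).ofReal_comp
  have h2 : deriv (flowSymbol t) x = flowSymbol t x * _ :=
    ((h1.const_mul Complex.I).neg.cexp).deriv
  rw [h2, norm_mul, flowSymbol, hnorm, one_mul, norm_neg, norm_mul, Complex.norm_I, one_mul, Complex.norm_real,
    Real.norm_eq_abs, abs_mul]
  gcongr
  set y := 2 * Real.pi * x
  have hy : |y| ≤ √(1 + y ^ 2) := Real.abs_le_sqrt (by linarith)
  have hpos : 0 < √(1 + y ^ 2) := by positivity
  rw [abs_div, abs_of_pos (show 0 < 2 * √(1 + y ^ 2) by positivity), div_le_iff₀ (by positivity),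
    abs_mul, abs_mul, abs_two, abs_of_pos (show 0 < 2 * Real.pi by positivity)]
  nlinarith [Real.pi_pos]

/-! ### Coordinates on `H^{1/2-}_loc` -/

/-- Separability makes the Borel `σ`-algebra of the countable power of `L2` the product one, so that
measurability can be tested on single coordinates. -/
instance : SecondCountableTopology L2 :=
  haveI : Fact ((2 : ℝ≥0∞) ≠ ∞) := ⟨by norm_num⟩
  inferInstance

instance : MeasurableSpace L2 := borel L2

instance : BorelSpace L2 := ⟨rfl⟩

/-- The exponents `1/2 - 1/(l+1)`, which increase to `1/2`. -/
def expo (l : ℕ) : ℝ := 1 / 2 - 1 / ((l : ℝ) + 1)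

theorem expo_lt (l : ℕ) : expo l < 1 / 2 := HalfLoc.index_lt l

theorem exists_le_expo {s : ℝ} (hs : s < 1 / 2) : ∃ l, s ≤ expo l := by
  obtain ⟨l, hl⟩ := exists_nat_one_div_lt (sub_pos.2 hs)
  exact ⟨l, by rw [expo]; linarith⟩

/-- The interval `[-(n+1), n+1]`. -/
def window (n : ℕ) : Set ℝ := Set.Icc (-((n : ℝ) + 1)) ((n : ℝ) + 1)

theorem measurableSet_window (n : ℕ) : MeasurableSet (window n) := measurableSet_Icc

theorem norm_wt_le_of_mem_window {n : ℕ} {x : ℝ} (hx : x ∈ window n) : ‖wt x‖ ≤ (n : ℝ) + 2 := by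
  have h : |x| ≤ (n : ℝ) + 1 := abs_le.2 hx
  have h' := norm_wt_sq x
  have h2 : x ^ 2 ≤ ((n : ℝ) + 1) ^ 2 := sq_le_sq.2 (h.trans (le_abs_self _))
  refine abs_le_of_sq_le_sq' ?_ (by positivity) |>.2
  nlinarith

theorem isL2LocRep_wtDist (g : L2) : IsL2LocRep (wtDist g) fun x => wt x * g x := by
  refine ⟨fun R => ?_, fun ψ _ => wtDist_apply g ψ⟩
  have hg : MemLp g 2 (volume.restrict (Set.Icc (-R) R)) := (Lp.memLp g).restrict _
  have hw : AEStronglyMeasurable wt (volume.restrict (Set.Icc (-R) R)) :=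
    continuous_wt.aestronglyMeasurable
  obtain ⟨C, hC⟩ := isCompact_Icc.exists_bound_of_continuousOn
    (s := Set.Icc (-R) R) continuous_wt.continuousOn
  refine (hg.const_mul (C : ℂ)).mono (hw.mul hg.1) ?_
  refine (ae_restrict_iff' measurableSet_Icc).2 (Eventually.of_forall fun x hx => ?_)
  rw [norm_mul, norm_mul]
  have := hC x hx
  gcongr
  rw [Complex.norm_real]
  exact this.trans (le_abs_self C)

namespace HalfLoc

theorem ext_val {u v : HalfLoc} (h : u.val = v.val) : u = v := by
  cases u
  cases v
  simpa using h

/-- The `L²_loc` function `D^s u` at the exponent `s = expo l`. -/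
def rep (l : ℕ) (u : HalfLoc) : ℝ → ℂ := l2LocRep (besselD (expo l) u.val)

theorem isL2LocRep_rep (l : ℕ) (u : HalfLoc) : IsL2LocRep (besselD (expo l) u.val) (rep l u) :=
  (u.mem (expo l) (expo_lt l)).choose_spec.l2LocRep

theorem memLp_window {T : 𝓢'(ℝ, ℂ)} {g : ℝ → ℂ} (h : IsL2LocRep T g) (n : ℕ) :
    MemLp ((window n).indicator fun x => (wt x)⁻¹ * g x) 2 volume := by
  rw [memLp_indicator_iff_restrict (measurableSet_window n)]
  refine (h.1 (n + 1)).mono ?_ (Eventually.of_forall fun x => ?_)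
  · exact ((continuous_wt.inv₀ wt_ne_zero).aestronglyMeasurable).mul (h.1 (n + 1)).1
  · rw [norm_mul]
    exact mul_le_of_le_one_left (norm_nonneg _) (norm_wt_inv_le x)

/-- The coordinate `1_{[-(n+1), n+1]} w⁻¹ D^s u` of `u`, at the exponent `s = expo l`. -/
def coord (n l : ℕ) (u : HalfLoc) : L2 := (memLp_window (isL2LocRep_rep l u) n).toLp _

theorem coord_eq_toLp {n l : ℕ} {u : HalfLoc} {g : ℝ → ℂ}
    (h : IsL2LocRep (besselD (expo l) u.val) g) : coord n l u = (memLp_window h n).toLp _ := by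
  refine MemLp.toLp_congr _ _ ?_
  filter_upwards [(isL2LocRep_rep l u).ae_eq h] with x hx
  by_cases hn : x ∈ window n <;> simp [hn, hx]

theorem norm_coord_sub (n l : ℕ) (u v : HalfLoc) {g : ℝ → ℂ}
    (hg : IsL2LocRep (besselD (expo l) (u.val - v.val)) g) :
    ‖coord n l u - coord n l v‖ =
      (eLpNorm (fun x => (wt x)⁻¹ * g x) 2 (volume.restrict (window n))).toReal := by
  have h1 : g =ᵐ[volume] rep l u + -rep l v := by
    refine hg.ae_eq ?_
    rw [sub_eq_add_neg, map_add, map_neg]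
    exact (isL2LocRep_rep l u).add (isL2LocRep_rep l v).neg
  rw [coord, coord, ← MemLp.toLp_sub, Lp.norm_toLp,
    ← eLpNorm_indicator_eq_eLpNorm_restrict (measurableSet_window n)]
  congr 1
  refine eLpNorm_congr_ae ?_
  filter_upwards [h1] with x hx
  by_cases hn : x ∈ window n
  · simp [hn, hx]
    ring
  · simp [hn]

theorem norm_coord_sub_le (n l : ℕ) (u v : HalfLoc) :
    ‖coord n l u - coord n l v‖ ≤ pNorm (n + 1) (expo l) (u.val - v.val) := by
  obtain ⟨g, hg⟩ := exists_rep_sub u v (expo_lt l)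
  rw [norm_coord_sub n l u v hg, pNorm_eq hg]
  refine ENNReal.toReal_mono (hg.1 _).eLpNorm_ne_top (eLpNorm_mono fun x => ?_)
  rw [norm_mul]
  exact mul_le_of_le_one_left (norm_nonneg _) (norm_wt_inv_le x)

/-- On the window `1 ≤ |w| ≤ n + 2`, so with `norm_coord_sub_le` the weight in the coordinates only
changes the seminorms by constants. -/
theorem pNorm_le_norm_coord_sub (n l : ℕ) (u v : HalfLoc) :
    pNorm (n + 1) (expo l) (u.val - v.val) ≤ (n + 2) * ‖coord n l u - coord n l v‖ := by
  obtain ⟨g, hg⟩ := exists_rep_sub u v (expo_lt l)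
  rw [norm_coord_sub n l u v hg, pNorm_eq hg]
  have hm : MemLp (fun x => (wt x)⁻¹ * g x) 2 (volume.restrict (window n)) :=
    (memLp_indicator_iff_restrict (measurableSet_window n)).1 (memLp_window hg n)
  have hle := eLpNorm_le_mul_eLpNorm_of_ae_le_mul (f := g) (g := fun x => (wt x)⁻¹ * g x)
    (c := n + 2) (μ := volume.restrict (window n)) (by
      refine (ae_restrict_iff' (measurableSet_window n)).2 (Eventually.of_forall fun x hx => ?_)
      rw [norm_mul, norm_inv]
      have h1 := norm_wt_le_of_mem_window hx
      have h2 : 0 < ‖wt x‖ := norm_pos_iff.2 (wt_ne_zero x)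
      calc ‖g x‖ = ‖wt x‖ * (‖wt x‖⁻¹ * ‖g x‖) := by field_simp
        _ ≤ _ := by gcongr) 2
  have := ENNReal.toReal_mono (ENNReal.mul_ne_top ENNReal.ofReal_ne_top hm.eLpNorm_ne_top) hle
  rwa [ENNReal.toReal_mul, ENNReal.toReal_ofReal (by positivity)] at this

/-- Dominated convergence for the series defining `d`: its terms are bounded by the geometric
weights. -/
theorem tendsto_of_tendsto_pNorm {α : Type*} {F : Filter α} {f : α → HalfLoc} {u : HalfLoc}
    (h : ∀ n l : ℕ, Tendsto (fun a => pNorm (n + 1) (expo l) ((f a).val - u.val)) F (𝓝 0)) :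
    Tendsto f F (𝓝 u) := by
  rw [tendsto_iff_dist_tendsto_zero]
  have hs : Summable fun i : ℕ × ℕ => (1 / 2 : ℝ) ^ ((i.1 + 1) + (i.2 + 1)) := by
    have h : Summable fun i : ℕ × ℕ => (1 / 2 : ℝ) ^ i.1 * (1 / 2 : ℝ) ^ i.2 :=
      summable_geometric_two.mul_of_nonneg summable_geometric_two
        (fun _ => by positivity) (fun _ => by positivity)
    refine (h.mul_left (1 / 4)).congr fun i => ?_
    ring
  have : Tendsto _ F _ := tendsto_tsum_of_dominated_convergence (g := fun _ : ℕ × ℕ => (0 : ℝ))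
    (f := fun a (i : ℕ × ℕ) => (1 / 2 : ℝ) ^ ((i.1 + 1) + (i.2 + 1)) *
      (pNorm (i.1 + 1) (1 / 2 - 1 / (i.2 + 1)) ((f a).val - u.val) /
        (1 + pNorm (i.1 + 1) (1 / 2 - 1 / (i.2 + 1)) ((f a).val - u.val)))) hs ?_ ?_
  · rw [tsum_zero] at this
    exact this
  · rintro ⟨n, l⟩
    have h1 := h n l
    have h2 := ((h1.div (h1.const_add 1) (by simp)).const_mul ((1 / 2 : ℝ) ^ ((n + 1) + (l + 1))))
    simpa [expo] using h2
  · refine Eventually.of_forall fun a i => ?_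
    have hp := pNorm_nonneg (i.1 + 1) (1 / 2 - 1 / (i.2 + 1)) ((f a).val - u.val)
    rw [Real.norm_of_nonneg (by positivity)]
    exact mul_le_of_le_one_right (by positivity) (div_one_add_le_one hp)

/-- A single term of the series is at most the distance, and `q = p / (1 + p)` is inverted by `p = q
/ (1 - q)`. -/
theorem tendsto_pNorm_of_tendsto {α : Type*} {F : Filter α} {f : α → HalfLoc} {u : HalfLoc}
    (h : Tendsto f F (𝓝 u)) (n l : ℕ) :
    Tendsto (fun a => pNorm (n + 1) (expo l) ((f a).val - u.val)) F (𝓝 0) := by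
  rw [tendsto_iff_dist_tendsto_zero] at h
  set p : α → ℝ := fun a => pNorm (n + 1) (expo l) ((f a).val - u.val) with hp
  have hp0 : ∀ a, 0 ≤ p a := fun a => pNorm_nonneg _ _ _
  set c : ℝ := (1 / 2 : ℝ) ^ ((n + 1) + (l + 1)) with hc
  have hc0 : 0 < c := by positivity
  have h1 : ∀ a, p a / (1 + p a) ≤ c⁻¹ * dist (f a) u := by
    intro a
    have h2 := (summable_hdist (f a) u).le_tsum (n, l) (fun i _ => by
      have := pNorm_nonneg (i.1 + 1) (1 / 2 - 1 / (i.2 + 1)) ((f a).val - u.val)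
      positivity)
    have h3 : c * (p a / (1 + p a)) ≤ dist (f a) u := h2
    rw [inv_mul_eq_div, le_div_iff₀ hc0]
    linarith
  have hq : Tendsto (fun a => p a / (1 + p a)) F (𝓝 0) := by
    refine squeeze_zero (fun a => by have := hp0 a; positivity) h1 ?_
    simpa using h.const_mul c⁻¹
  have h4 := hq.div (hq.const_sub 1) (by simp)
  simp only [sub_zero, div_one] at h4
  refine h4.congr fun a => ?_
  have := hp0 a
  simp only [Pi.div_apply]
  field_simp
  ring

/-- The family of all coordinates. -/
def coords (u : HalfLoc) (i : ℕ × ℕ) : L2 := coord i.1 i.2 u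

theorem tendsto_iff_coord {α : Type*} {F : Filter α} {f : α → HalfLoc} {u : HalfLoc} :
    Tendsto f F (𝓝 u) ↔ ∀ n l, Tendsto (fun a => coord n l (f a)) F (𝓝 (coord n l u)) := by
  constructor
  · intro h n l
    rw [tendsto_iff_norm_sub_tendsto_zero]
    exact squeeze_zero (fun a => norm_nonneg _) (fun a => norm_coord_sub_le n l (f a) u)
      (tendsto_pNorm_of_tendsto h n l)
  · intro h
    refine tendsto_of_tendsto_pNorm fun n l => ?_
    have := (tendsto_iff_norm_sub_tendsto_zero.1 (h n l)).const_mul ((n : ℝ) + 2)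
    rw [mul_zero] at this
    exact squeeze_zero (fun a => pNorm_nonneg _ _ _)
      (fun a => pNorm_le_norm_coord_sub n l (f a) u) this

theorem isInducing_coords : IsInducing coords := by
  rw [isInducing_iff_nhds]
  intro u
  refine le_antisymm ?_ ?_
  · rw [← tendsto_iff_comap, tendsto_pi_nhds]
    rintro ⟨n, l⟩
    exact tendsto_iff_coord.1 tendsto_id n l
  · have h : Tendsto coords (comap coords (𝓝 (coords u))) (𝓝 (coords u)) := tendsto_comap
    rw [tendsto_pi_nhds] at h
    exact tendsto_iff_coord.2 fun n l => h (n, l)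

/-- The topology is induced by the coordinates, hence so is the Borel `σ`-algebra. All measurability
questions on `H^{1/2-}_loc` thereby become questions in `L²`. -/
theorem measurable_iff_coord {α : Type*} [MeasurableSpace α] {f : α → HalfLoc} :
    Measurable f ↔ ∀ n l, Measurable fun a => coord n l (f a) := by
  have h : borel HalfLoc =
      MeasurableSpace.comap coords (inferInstance : MeasurableSpace (ℕ × ℕ → L2)) := by
    rw [BorelSpace.measurable_eq (α := ℕ × ℕ → L2), isInducing_coords.eq_induced]
    exact borel_comap
  change @Measurable α HalfLoc _ (borel HalfLoc) f ↔ _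
  rw [h, measurable_comap_iff, measurable_pi_iff, Prod.forall]
  rfl

theorem measurable_coord (n l : ℕ) : Measurable (coord n l) :=
  measurable_iff_coord.1 measurable_id n l

/-! ### The distributions with weighted derivatives -/

/-- The elements with `w⁻¹ D^s u ∈ L²` for all the exponents `s`. -/
def tame : Set HalfLoc := {u | ∀ l, ∃ g : L2, besselD (expo l) u.val = wtDist g}

end HalfLoc

theorem besselD_besselD (s s' : ℝ) (T : 𝓢'(ℝ, ℂ)) :
    besselD s (besselD s' T) = besselD (s + s') T := by
  rw [besselD, besselD, TemperedDistribution.fourierMultiplierCLM_fourierMultiplierCLM_apply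
    (besselSymbol_hasTemperateGrowth _) (besselSymbol_hasTemperateGrowth _), besselD]
  congr 2
  ext ξ
  simp only [Pi.mul_apply, besselSymbol]
  rw [← Complex.ofReal_mul, ← Real.rpow_add (by positivity)]
  congr 2
  ring

theorem besselD_zero (T : 𝓢'(ℝ, ℂ)) : besselD 0 T = T := by
  have : besselSymbol 0 = fun _ => 1 := by
    ext ξ
    simp [besselSymbol]
  rw [besselD, this, TemperedDistribution.fourierMultiplierCLM_const]
  simp

theorem besselD_linFlow (s t : ℝ) (T : 𝓢'(ℝ, ℂ)) :
    besselD s (linFlow t T) = linFlow t (besselD s T) := by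
  rw [besselD, linFlow, TemperedDistribution.fourierMultiplierCLM_fourierMultiplierCLM_apply
    (flowSymbol_hasTemperateGrowth _) (besselSymbol_hasTemperateGrowth _),
    TemperedDistribution.fourierMultiplierCLM_fourierMultiplierCLM_apply
    (besselSymbol_hasTemperateGrowth _) (flowSymbol_hasTemperateGrowth _), mul_comm]

/-- The operator `w⁻¹ L(t) w` on `L²(ℝ)`. -/
def flowL2 (t : ℝ) : L2 →L[ℂ] L2 := (isMultiplier_flowSymbol t).conj

theorem linFlow_wtDist (t : ℝ) (g : L2) : linFlow t (wtDist g) = wtDist (flowL2 t g) :=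
  (isMultiplier_flowSymbol t).fourierMultiplier_wtDist g

namespace HalfLoc

/-- A distribution with weighted derivatives at the exponents `expo l` has them at all orders. -/
def ofTame (T : 𝓢'(ℝ, ℂ)) (h : ∀ l, ∃ g : L2, besselD (expo l) T = wtDist g) : HalfLoc where
  val := T
  mem s hs := by
    obtain ⟨l, hl⟩ := exists_le_expo hs
    obtain ⟨g, hg⟩ := h l
    have hm := isMultiplier_besselSymbol (sub_nonpos.2 hl)
    refine ⟨fun x => wt x * hm.conj g x, ?_⟩
    -- `D^s` is `D^{s - expo l}` after `D^{expo l}`, and the first has order at most `0`, so it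
    -- preserves `w L²`.
    have : besselD s T = wtDist (hm.conj g) := by
      rw [← hm.fourierMultiplier_wtDist, ← hg]
      change _ = besselD (s - expo l) (besselD (expo l) T)
      rw [besselD_besselD, sub_add_cancel]
    rw [this]
    exact isL2LocRep_wtDist _

theorem memLp_window_one (n : ℕ) :
    MemLp ((window n).indicator fun _ => (1 : ℂ)) ∞ (volume : Measure ℝ) :=
  memLp_top_of_bound ((measurable_const.indicator (measurableSet_window n)).aestronglyMeasurable) 1
    (Eventually.of_forall fun x => by
      by_cases hx : x ∈ window n <;> simp [hx])

/-- The restriction to `[-(n+1), n+1]`. -/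
def cutL2 (n : ℕ) : L2 →L[ℂ] L2 := mulL2 (memLp_window_one n)

theorem coord_of_wtDist {n l : ℕ} {u : HalfLoc} {g : L2}
    (h : besselD (expo l) u.val = wtDist g) : coord n l u = cutL2 n g := by
  rw [coord_eq_toLp (g := fun x => wt x * g x) (h ▸ isL2LocRep_wtDist g)]
  refine Lp.ext ?_
  filter_upwards [MemLp.coeFn_toLp (memLp_window (h ▸ isL2LocRep_wtDist g :
    IsL2LocRep (besselD (expo l) u.val) fun x => wt x * g x) n),
    coeFn_mulL2 (memLp_window_one n) g] with x h1 h2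
  rw [h1, cutL2, h2]
  by_cases hx : x ∈ window n <;> simp [hx, inv_mul_cancel_left₀ (wt_ne_zero x)]

/-- The squared error is the integral of `|g|²` outside the window, which vanishes by dominated
convergence. -/
theorem tendsto_cutL2 (g : L2) : Tendsto (fun n => cutL2 n g) atTop (𝓝 g) := by
  rw [Lp.tendsto_Lp_iff_tendsto_eLpNorm']
  have hpow : ∀ n, eLpNorm (cutL2 n g - g : ℝ → ℂ) 2 volume =
      (∫⁻ x, (window n)ᶜ.indicator (fun x => ‖g x‖ₑ ^ (2 : ℝ)) x) ^ (1 / 2 : ℝ) := by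
    intro n
    rw [eLpNorm_eq_lintegral_rpow_enorm_toReal (by norm_num) (by norm_num)]
    simp only [ENNReal.toReal_ofNat]
    congr 1
    refine lintegral_congr_ae ?_
    filter_upwards [coeFn_mulL2 (memLp_window_one n) g] with x hx
    rw [Pi.sub_apply, cutL2, hx]
    by_cases hn : x ∈ window n <;> simp [hn]
  simp only [hpow]
  have hfin : ∫⁻ x, ‖g x‖ₑ ^ (2 : ℝ) ≠ ∞ := by
    have := (Lp.memLp g).eLpNorm_lt_top
    rw [eLpNorm_lt_top_iff_lintegral_rpow_enorm_lt_top (by norm_num) (by norm_num)] at this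
    simpa using this.ne
  have hmeas : Measurable fun x => ‖g x‖ₑ ^ (2 : ℝ) :=
    (Lp.stronglyMeasurable g).measurable.enorm.pow_const _
  have hlim := tendsto_lintegral_of_dominated_convergence (μ := volume)
    (F := fun n x => (window n)ᶜ.indicator (fun x => ‖g x‖ₑ ^ (2 : ℝ)) x) (f := fun _ => 0)
    (fun x => ‖g x‖ₑ ^ (2 : ℝ)) (fun n => hmeas.indicator (measurableSet_window n).compl)
    (fun n => Eventually.of_forall fun x => Set.indicator_le_self _ _ x) hfin
    (Eventually.of_forall fun x => by
      obtain ⟨N, hN⟩ := exists_nat_ge |x|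
      refine tendsto_const_nhds.congr' ?_
      filter_upwards [eventually_ge_atTop N] with n hn
      have : x ∈ window n := by
        have : (N : ℝ) ≤ n := by exact_mod_cast hn
        exact abs_le.1 (by linarith)
      simp [this])
  simp only [lintegral_zero] at hlim
  simpa using hlim.ennrpow_const (1 / 2)

/-- Against a test function of compact support, the pairing with `w` times the coordinate is
constant once the window contains the support. Such test functions determine the distribution. -/
theorem exists_wtDist_of_tendsto {l : ℕ} {u : HalfLoc} {g : L2}
    (h : Tendsto (fun n => coord n l u) atTop (𝓝 g)) : besselD (expo l) u.val = wtDist g := by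
  refine ext_of_hasCompactSupport fun ψ hψ => ?_
  have h1 : Tendsto (fun n => wtDist (coord n l u) ψ) atTop (𝓝 (wtDist g ψ)) :=
    (((PointwiseConvergenceCLM.evalCLM _ _ ψ).continuous.comp wtDist.continuous).tendsto g).comp h
  refine tendsto_nhds_unique (tendsto_const_nhds.congr' ?_) h1
  obtain ⟨R, hR⟩ := hψ.isBounded.subset_closedBall 0
  obtain ⟨N, hN⟩ := exists_nat_ge R
  filter_upwards [eventually_ge_atTop N] with n hn
  rw [(isL2LocRep_rep l u).2 ψ hψ, wtDist_apply]
  refine integral_congr_ae ?_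
  filter_upwards [MemLp.coeFn_toLp (memLp_window (isL2LocRep_rep l u) n)] with x hx
  by_cases hx' : x ∈ tsupport ψ
  · have : x ∈ window n := by
      have h2 := hR hx'
      rw [mem_closedBall_zero_iff, Real.norm_eq_abs] at h2
      have : (N : ℝ) ≤ n := by exact_mod_cast hn
      exact abs_le.1 (by linarith)
    rw [coord, hx, Set.indicator_of_mem this, mul_inv_cancel_left₀ (wt_ne_zero x)]
  · rw [image_eq_zero_of_notMem_tsupport hx', zero_mul, zero_mul]

/-- Existence of a weighted derivative is rewritten as convergence of a sequence of measurable maps;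
this is why `tame` is a Borel set. -/
theorem mem_tame_iff {u : HalfLoc} :
    u ∈ tame ↔ ∀ l, ∃ g, Tendsto (fun n => coord n l u) atTop (𝓝 g) := by
  refine forall_congr' fun l => exists_congr fun g => ⟨fun h => ?_, exists_wtDist_of_tendsto⟩
  simpa only [coord_of_wtDist h] using tendsto_cutL2 g

theorem measurableSet_tame : MeasurableSet tame := by
  have : tame = ⋂ l, {u | ∃ g, Tendsto (fun n => coord n l u) atTop (𝓝 g)} := by
    ext u
    simp [mem_tame_iff]
  rw [this]
  exact MeasurableSet.iInter fun l => measurableSet_exists_tendsto fun n => measurable_coord n l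

/-- `w⁻¹ D^s u` as an element of `L²`, for tame `u`. -/
def weighted (l : ℕ) (u : HalfLoc) : L2 := limUnder atTop fun n => coord n l u

theorem weighted_eq {l : ℕ} {u : HalfLoc} {g : L2} (h : besselD (expo l) u.val = wtDist g) :
    weighted l u = g := by
  have : Tendsto (fun n => coord n l u) atTop (𝓝 g) := by
    simpa only [coord_of_wtDist h] using tendsto_cutL2 g
  exact this.limUnder_eq

theorem besselD_of_mem_tame {u : HalfLoc} (hu : u ∈ tame) (l : ℕ) :
    besselD (expo l) u.val = wtDist (weighted l u) := by
  obtain ⟨g, hg⟩ := hu l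
  rw [weighted_eq hg, hg]

theorem measurable_weighted (l : ℕ) : Measurable (weighted l) :=
  (StronglyMeasurable.limUnder fun n => (measurable_coord n l).stronglyMeasurable).measurable

theorem besselD_linFlow_of_mem_tame {u : HalfLoc} (hu : u ∈ tame) (t : ℝ) (l : ℕ) :
    besselD (expo l) (linFlow t u.val) = wtDist (flowL2 t (weighted l u)) := by
  rw [besselD_linFlow, besselD_of_mem_tame hu, linFlow_wtDist]

/-! ### The flow on tame elements -/

open Classical in
/-- The linear Klein-Gordon flow on the tame elements, extended by the identity. -/
def flow (t : ℝ) (u : HalfLoc) : HalfLoc :=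
  if hu : u ∈ tame then ofTame (linFlow t u.val) fun l => ⟨_, besselD_linFlow_of_mem_tame hu t l⟩
  else u

theorem flow_val {u : HalfLoc} (hu : u ∈ tame) (t : ℝ) : (flow t u).val = linFlow t u.val := by
  rw [flow, dif_pos hu]
  rfl

theorem coord_flow {u : HalfLoc} (hu : u ∈ tame) (t : ℝ) (n l : ℕ) :
    coord n l (flow t u) = cutL2 n (flowL2 t (weighted l u)) :=
  coord_of_wtDist (by rw [flow_val hu, besselD_linFlow_of_mem_tame hu])

theorem measurable_flow (t : ℝ) : Measurable (flow t) := by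
  classical
  rw [measurable_iff_coord]
  intro n l
  have : (fun u => coord n l (flow t u)) = fun u =>
      if u ∈ tame then cutL2 n (flowL2 t (weighted l u)) else coord n l u := by
    ext1 u
    split_ifs with hu
    · exact coord_flow hu t n l
    · rw [flow, dif_neg hu]
  rw [this]
  refine Measurable.ite measurableSet_tame ?_ (measurable_coord n l)
  exact ((cutL2 n).continuous.comp (flowL2 t).continuous).measurable.comp (measurable_weighted l)

/-- The set `flowPreimage t A` is compared with a Borel set on `tame` only, since off `tame` the map
`flow t` is a placeholder. Its measurability will hence be up to null sets. -/
theorem flowPreimage_inter_tame (t : ℝ) (A : Set HalfLoc) :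
    flowPreimage t A ∩ tame = flow t ⁻¹' A ∩ tame := by
  ext u
  simp only [flowPreimage, Set.mem_inter_iff, Set.mem_ofPred_eq, Set.mem_preimage]
  refine and_congr_left fun hu => ⟨?_, fun h => ⟨_, h, flow_val hu t⟩⟩
  rintro ⟨v, hv, h⟩
  rwa [ext_val ((flow_val hu t).trans h.symm)]

/-- Convergence of the weighted derivatives in `L²` implies convergence in `H^{1/2-}_loc`. -/
theorem tendsto_of_tendsto_wtDist {α : Type*} {F : Filter α} {f : α → HalfLoc} {u : HalfLoc}
    {g : α → ℕ → L2} {g₀ : ℕ → L2} (hf : ∀ a l, besselD (expo l) (f a).val = wtDist (g a l))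
    (hu : ∀ l, besselD (expo l) u.val = wtDist (g₀ l))
    (h : ∀ l, Tendsto (fun a => g a l) F (𝓝 (g₀ l))) : Tendsto f F (𝓝 u) := by
  rw [tendsto_iff_coord]
  intro n l
  simp only [coord_of_wtDist (hf _ l), coord_of_wtDist (hu l)]
  exact ((cutL2 n).continuous.tendsto _).comp (h l)

/-- The substitute for continuity of the flow: convergence is assumed in `w L²`, where `L(t)` is
bounded, and concluded in the weaker topology of `d`. -/
theorem tendsto_flow_of_tendsto_wtDist {α : Type*} {F : Filter α} {f : α → HalfLoc} {u : HalfLoc}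
    {g : α → ℕ → L2} {g₀ : ℕ → L2} (hf : ∀ a l, besselD (expo l) (f a).val = wtDist (g a l))
    (hu : ∀ l, besselD (expo l) u.val = wtDist (g₀ l))
    (h : ∀ l, Tendsto (fun a => g a l) F (𝓝 (g₀ l))) (t : ℝ) :
    Tendsto (fun a => flow t (f a)) F (𝓝 (flow t u)) := by
  have key : ∀ {v : HalfLoc} {k : ℕ → L2}, (∀ l, besselD (expo l) v.val = wtDist (k l)) →
      ∀ l, besselD (expo l) (flow t v).val = wtDist (flowL2 t (k l)) := by
    intro v k hv l
    rw [flow_val (fun l => ⟨_, hv l⟩), besselD_linFlow, hv, linFlow_wtDist]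
  exact tendsto_of_tendsto_wtDist (fun a => key (hf a)) (key hu)
    fun l => ((flowL2 t).continuous.tendsto _).comp (h l)

end HalfLoc

/-! ### Complex Gaussian laws and Brownian increments -/

theorem measurable_pairToComplex : Measurable fun p : ℝ × ℝ => (p.1 : ℂ) + p.2 * Complex.I := by
  fun_prop

instance (v : ℝ≥0) : IsProbabilityMeasure (complexGaussian v) :=
  Measure.isProbabilityMeasure_map measurable_pairToComplex.aemeasurable

/-- The real and imaginary parts are independent of variance `v/2` each. The result depends on `‖t‖`
only, which is the source of rotation invariance. -/
theorem charFun_complexGaussian (v : ℝ≥0) (t : ℂ) :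
    charFun (complexGaussian v) t = Complex.exp (-(v / 4 * (‖t‖ ^ 2 : ℝ) : ℂ)) := by
  rw [charFun_apply, complexGaussian, integral_map measurable_pairToComplex.aemeasurable
    (by fun_prop)]
  have h : ∀ p : ℝ × ℝ, Complex.exp (inner ℝ ((p.1 : ℂ) + p.2 * Complex.I) t * Complex.I) =
      Complex.exp (t.re * p.1 * Complex.I) * Complex.exp (t.im * p.2 * Complex.I) := by
    intro p
    rw [← Complex.exp_add]
    congr 1
    simp [Complex.inner]
    ring
  simp_rw [h]
  rw [integral_prod_mul (fun y : ℝ => Complex.exp (t.re * y * Complex.I))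
    (fun y : ℝ => Complex.exp (t.im * y * Complex.I)), ← charFun_apply_real, ← charFun_apply_real,
    charFun_gaussianReal, charFun_gaussianReal, ← Complex.exp_add]
  congr 1
  rw [← Complex.normSq_eq_norm_sq, Complex.normSq_apply]
  push_cast
  ring

/-- Circular complex Gaussian laws are invariant under rotations. -/
theorem complexGaussian_map_mul (v : ℝ≥0) {c : ℂ} (hc : ‖c‖ = 1) :
    (complexGaussian v).map (fun z => c * z) = complexGaussian v := by
  have : IsProbabilityMeasure ((complexGaussian v).map fun z => c * z) :=
    Measure.isProbabilityMeasure_map (by fun_prop)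
  refine Measure.ext_of_charFun ?_
  ext t
  have h : charFun ((complexGaussian v).map fun z => c * z) t =
      charFun (complexGaussian v) (starRingEnd ℂ c * t) := by
    rw [charFun_apply, charFun_apply, integral_map (by fun_prop) (by fun_prop)]
    refine integral_congr_ae (Eventually.of_forall fun z => ?_)
    simp only [Complex.inner, map_mul]
    congr 4
    ring
  rw [h, charFun_complexGaussian, charFun_complexGaussian, norm_mul, RCLike.norm_conj, hc, one_mul]

theorem integral_sq_gaussianReal (v : ℝ≥0) : ∫ x, x ^ 2 ∂gaussianReal 0 v = v := by
  have h := variance_id_gaussianReal (μ := 0) (v := v)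
  rw [variance_eq_integral aemeasurable_id] at h
  simpa using h

theorem integrable_sq_gaussianReal (v : ℝ≥0) : Integrable (fun x => x ^ 2) (gaussianReal 0 v) :=
  (memLp_id_gaussianReal' (μ := 0) (v := v) 2 (by norm_num)).integrable_sq

theorem memLp_id_complexGaussian (v : ℝ≥0) : MemLp id 2 (complexGaussian v) := by
  rw [complexGaussian, memLp_map_measure_iff aestronglyMeasurable_id
    measurable_pairToComplex.aemeasurable]
  have h := (memLp_id_gaussianReal' (μ := 0) (v := v / 2) 2 (by norm_num)).ofReal (K := ℂ)
  exact (h.comp_fst _).add ((h.comp_snd _).mul_const Complex.I)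

theorem integral_id_complexGaussian (v : ℝ≥0) : ∫ z, z ∂complexGaussian v = 0 := by
  rw [complexGaussian, integral_map measurable_pairToComplex.aemeasurable (by fun_prop)]
  have h := ((memLp_id_gaussianReal' (μ := 0) (v := v / 2) 2 (by norm_num)).integrable
    (by norm_num)).ofReal (𝕜 := ℂ)
  have h0 : ∫ x, (x : ℂ) ∂gaussianReal 0 (v / 2) = 0 := by
    rw [integral_complex_ofReal, integral_id_gaussianReal, Complex.ofReal_zero]
  have h1 := integral_fun_fst (μ := gaussianReal 0 (v / 2)) (ν := gaussianReal 0 (v / 2))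
    fun x : ℝ => (x : ℂ)
  have h2 := integral_fun_snd (μ := gaussianReal 0 (v / 2)) (ν := gaussianReal 0 (v / 2))
    fun x : ℝ => (x : ℂ)
  rw [h0, smul_zero] at h1 h2
  have hi := h.comp_fst (gaussianReal 0 (v / 2))
  have hi' := (h.comp_snd (gaussianReal 0 (v / 2))).mul_const Complex.I
  calc _ = (∫ p : ℝ × ℝ, (p.1 : ℂ) ∂(gaussianReal 0 (v / 2)).prod (gaussianReal 0 (v / 2))) +
        ∫ p : ℝ × ℝ, (p.2 : ℂ) * Complex.I ∂(gaussianReal 0 (v / 2)).prod (gaussianReal 0 (v / 2)) :=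
        integral_add hi hi'
    _ = 0 := by rw [h1, integral_mul_const, h2, zero_mul, add_zero]

theorem integral_norm_sq_complexGaussian (v : ℝ≥0) :
    ∫ z, ‖z‖ ^ 2 ∂complexGaussian v = v := by
  rw [complexGaussian, integral_map measurable_pairToComplex.aemeasurable (by fun_prop)]
  have hn : ∀ p : ℝ × ℝ, ‖(p.1 : ℂ) + p.2 * Complex.I‖ ^ 2 = p.1 ^ 2 + p.2 ^ 2 := by
    intro p
    rw [← Complex.normSq_eq_norm_sq, Complex.normSq_add_mul_I]
  simp_rw [hn]
  have h := integrable_sq_gaussianReal (v / 2)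
  rw [integral_add (h.comp_fst _) (h.comp_snd _),
    integral_fun_fst fun x : ℝ => x ^ 2, integral_fun_snd fun x : ℝ => x ^ 2,
    integral_sq_gaussianReal]
  simp

section Orthogonal

variable {Ω : Type*} [MeasurableSpace Ω] {P : Measure Ω}

/-- Pythagoras' theorem for centred and pairwise independent variables. -/
theorem integral_norm_sq_sum_of_indep {ι : Type*} (S : Finset ι) (Z : ι → Ω → ℂ) (c : ι → ℂ)
    (hZ : ∀ i ∈ S, MemLp (Z i) 2 P) (h0 : ∀ i ∈ S, ∫ ω, Z i ω ∂P = 0)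
    (hi : ∀ i ∈ S, ∀ j ∈ S, i ≠ j → Z i ⟂ᵢ[P] Z j) :
    ∫ ω, ‖∑ i ∈ S, c i * Z i ω‖ ^ 2 ∂P = ∑ i ∈ S, ‖c i‖ ^ 2 * ∫ ω, ‖Z i ω‖ ^ 2 ∂P := by
  classical
  have hint : ∀ i ∈ S, ∀ j ∈ S,
      Integrable (fun ω => (c i * Z i ω) * starRingEnd ℂ (c j * Z j ω)) P := fun i hi j hj =>
    ((hZ i hi).const_mul (c i)).integrable_mul ((hZ j hj).const_mul (c j)).star
  have hexp : ∀ ω, ((‖∑ i ∈ S, c i * Z i ω‖ ^ 2 : ℝ) : ℂ) =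
      ∑ i ∈ S, ∑ j ∈ S, (c i * Z i ω) * starRingEnd ℂ (c j * Z j ω) := by
    intro ω
    rw [Complex.ofReal_pow, ← Complex.mul_conj', map_sum, Finset.sum_mul_sum]
  have hoff : ∀ i ∈ S, ∀ j ∈ S, ∫ ω, (c i * Z i ω) * starRingEnd ℂ (c j * Z j ω) ∂P =
      if i = j then ((‖c i‖ ^ 2 * ∫ ω, ‖Z i ω‖ ^ 2 ∂P : ℝ) : ℂ) else 0 := by
    intro i hiS j hjS
    split_ifs with hij
    · subst hij
      rw [← integral_const_mul, ← integral_complex_ofReal]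
      refine integral_congr_ae (Eventually.of_forall fun ω => ?_)
      simp only [Complex.mul_conj']
      push_cast
      rw [norm_mul]
      push_cast
      ring
    · have hind : Z i ⟂ᵢ[P] fun ω => starRingEnd ℂ (Z j ω) :=
        (hi i hiS j hjS hij).comp measurable_id Complex.continuous_conj.measurable
      have := hind.integral_fun_mul_eq_mul_integral (hZ i hiS).1 (hZ j hjS).star.1
      rw [h0 i hiS, zero_mul] at this
      calc _ = ∫ ω, (c i * starRingEnd ℂ (c j)) * (Z i ω * starRingEnd ℂ (Z j ω)) ∂P := by
            refine integral_congr_ae (Eventually.of_forall fun ω => ?_)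
            simp only [map_mul]
            ring
        _ = 0 := by rw [integral_const_mul, this, mul_zero]
  apply Complex.ofReal_injective
  rw [← integral_complex_ofReal]
  simp_rw [hexp]
  rw [integral_finsetSum _ fun i hi => integrable_finsetSum _ fun j hj => hint i hi j hj]
  push_cast
  refine Finset.sum_congr rfl fun i hiS => ?_
  rw [integral_finsetSum _ fun j hj => hint i hiS j hj,
    Finset.sum_congr rfl fun j hj => hoff i hiS j hj, Finset.sum_ite_eq, if_pos hiS]
  push_cast
  rfl

end Orthogonal

/-! ### Brownian increments on a uniform grid -/

/-- The increment of `W` over the interval `[j/M, (j+1)/M]`. -/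
def incr {Ω : Type*} (W : ℝ → Ω → ℂ) (M : ℕ) (j : ℤ) (ω : Ω) : ℂ :=
  W (((j : ℝ) + 1) / M) ω - W ((j : ℝ) / M) ω

namespace IsComplexBrownian

variable {Ω : Type*} [MeasurableSpace Ω] {P : Measure Ω} {W : ℝ → Ω → ℂ}

theorem measurable_incr (hW : IsComplexBrownian W P) (M : ℕ) (j : ℤ) :
    Measurable (incr W M j) :=
  (hW.measurable _).sub (hW.measurable _)

theorem hasLaw_incr (hW : IsComplexBrownian W P) (M : ℕ) (j : ℤ) :
    HasLaw (incr W M j) (complexGaussian (M : ℝ≥0)⁻¹) P := by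
  have h := hW.law ((j : ℝ) / M) (((j : ℝ) + 1) / M)
  have hd : nndist ((j : ℝ) / M) (((j : ℝ) + 1) / M) = (M : ℝ≥0)⁻¹ := by
    rw [← NNReal.coe_inj, coe_nndist, Real.dist_eq, ← sub_div]
    simp [abs_div]
  rw [hd] at h
  exact h

/-- Independence of increments is available along monotone sequences of times indexed by `ℕ`, so the
integers of `[a, b)` are enumerated from `a` by `j ↦ (j - a).toNat`. -/
theorem iIndepFun_incr (hW : IsComplexBrownian W P) (M : ℕ) (a b : ℤ) :
    iIndepFun (fun j : Finset.Ico a b => incr W M j) P := by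
  have ht : Monotone fun n : ℕ => ((a : ℝ) + n) / M := fun m n hmn => by
    have : (m : ℝ) ≤ n := by exact_mod_cast hmn
    dsimp only
    gcongr
  have h := hW.indep.nat ht
  have hinj : Function.Injective fun j : Finset.Ico a b => ((j : ℤ) - a).toNat := by
    intro i j hij
    have hi := (Finset.mem_Ico.1 i.2).1
    have hj := (Finset.mem_Ico.1 j.2).1
    dsimp only at hij
    ext
    omega
  have h' := h.precomp hinj
  convert h' using 2 with j
  ext ω
  have hj := (Finset.mem_Ico.1 j.2).1
  have hcast : (a : ℝ) + (((j : ℤ) - a).toNat : ℝ) = (j : ℤ) := by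
    have : (((j : ℤ) - a).toNat : ℤ) = j - a := Int.toNat_of_nonneg (by omega)
    have h2 : (((j : ℤ) - a).toNat : ℝ) = ((j - a : ℤ) : ℝ) := by exact_mod_cast this
    rw [h2]
    push_cast
    ring
  simp only [incr]
  push_cast
  rw [← add_assoc, hcast]

theorem indepFun_incr (hW : IsComplexBrownian W P) (M : ℕ) {i j : ℤ} (hij : i ≠ j) :
    incr W M i ⟂ᵢ[P] incr W M j := by
  have h := hW.iIndepFun_incr M (min i j) (max i j + 1)
  have hi : i ∈ Finset.Ico (min i j) (max i j + 1) := by simp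
  have hj : j ∈ Finset.Ico (min i j) (max i j + 1) := by simp
  exact h.indepFun (i := ⟨i, hi⟩) (j := ⟨j, hj⟩) (by simpa using hij)

theorem memLp_incr (hW : IsComplexBrownian W P) (M : ℕ) (j : ℤ) : MemLp (incr W M j) 2 P := by
  have h := hW.hasLaw_incr M j
  have h2 := memLp_id_complexGaussian (M : ℝ≥0)⁻¹
  rw [← h.map_eq, memLp_map_measure_iff aestronglyMeasurable_id h.aemeasurable] at h2
  exact h2

/-- The isometry property of the stochastic integral of step functions. -/
theorem lintegral_enorm_sq_sum_incr (hW : IsComplexBrownian W P) (M : ℕ) (S : Finset ℤ)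
    (c : ℤ → ℂ) : ∫⁻ ω, ‖∑ j ∈ S, c j * incr W M j ω‖ₑ ^ 2 ∂P =
      ENNReal.ofReal (∑ j ∈ S, ‖c j‖ ^ 2 * (M : ℝ)⁻¹) := by
  have hmem : MemLp (fun ω => ∑ j ∈ S, c j * incr W M j ω) 2 P :=
    memLp_finsetSum _ fun j _ => (hW.memLp_incr M j).const_mul _
  have h := integral_norm_sq_sum_of_indep S (incr W M) c (fun j _ => hW.memLp_incr M j)
    (fun j _ => by
      have := (hW.hasLaw_incr M j).integral_comp (f := id) (by fun_prop)
      simpa [integral_id_complexGaussian] using this)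
    (fun i _ j _ hij => hW.indepFun_incr M hij)
  have hv : ∀ j, ∫ ω, ‖incr W M j ω‖ ^ 2 ∂P = (M : ℝ)⁻¹ := fun j => by
    have := (hW.hasLaw_incr M j).integral_comp (f := fun z : ℂ => ‖z‖ ^ 2) (by fun_prop)
    rw [integral_norm_sq_complexGaussian] at this
    simpa using this
  simp only [hv] at h
  rw [← h, ofReal_integral_eq_lintegral_ofReal (hmem.integrable_norm_pow (by norm_num)) (by
    exact Eventually.of_forall fun _ => by positivity)]
  refine lintegral_congr fun ω => ?_
  rw [ENNReal.ofReal_pow (norm_nonneg _), ofReal_norm]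

end IsComplexBrownian

/-! ### The Cauchy estimate for the approximating fields -/

/-- The integrand `(1 + n²)^{(s-1)/2} exp (i n x)` of `D^s φ`. -/
def integrand (s x n : ℝ) : ℂ :=
  (((1 + n ^ 2) ^ ((s - 1) / 2) : ℝ) : ℂ) * Complex.exp (Complex.I * n * x)

theorem approxField_eq {Ω : Type*} (W : ℝ → Ω → ℂ) (s : ℝ) (N R : ℕ) (ω : Ω) (x : ℝ) :
    approxField W s N R ω x = ∑ k ∈ Finset.Ico (-((N : ℤ) * R)) ((N : ℤ) * R),
      integrand s x ((k : ℝ) / N) * incr W N k ω := by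
  refine Finset.sum_congr rfl fun k _ => ?_
  rw [integrand, incr]
  ring

theorem sum_Ico_int_succ_top {a b : ℤ} (hab : a ≤ b) (f : ℤ → ℂ) :
    ∑ j ∈ Finset.Ico a (b + 1), f j = ∑ j ∈ Finset.Ico a b, f j + f b := by
  have : Finset.Ico a (b + 1) = insert b (Finset.Ico a b) := by
    ext j
    simp only [Finset.mem_Ico, Finset.mem_insert]
    omega
  rw [this, Finset.sum_insert (by simp), add_comm]

theorem sum_Ico_int_sub {a b : ℤ} (hab : a ≤ b) (V : ℤ → ℂ) :
    ∑ j ∈ Finset.Ico a b, (V (j + 1) - V j) = V b - V a := by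
  induction b, hab using Int.leInduction with
  | base => simp
  | succ b hab ih =>
    rw [sum_Ico_int_succ_top hab, ih]
    ring

/-- A step function of mesh `d` integrated over the finer mesh `1`. -/
theorem sum_Ico_int_refine {a b : ℤ} (hab : a ≤ b) {d : ℤ} (hd : 0 < d) (f V : ℤ → ℂ) :
    ∑ q ∈ Finset.Ico a b, f q * (V ((q + 1) * d) - V (q * d)) =
      ∑ j ∈ Finset.Ico (a * d) (b * d), f (j / d) * (V (j + 1) - V j) := by
  induction b, hab using Int.leInduction with
  | base => simp
  | succ b hab ih =>
    have h1 : a * d ≤ b * d := mul_le_mul_of_nonneg_right hab hd.le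
    have h2 : b * d ≤ (b + 1) * d := by nlinarith
    have hun : Finset.Ico (a * d) ((b + 1) * d) =
        Finset.Ico (a * d) (b * d) ∪ Finset.Ico (b * d) ((b + 1) * d) :=
      (Finset.Ico_union_Ico_eq_Ico h1 h2).symm
    rw [sum_Ico_int_succ_top hab, ih, hun, Finset.sum_union (Finset.Ico_disjoint_Ico_consecutive _ _ _)]
    congr 1
    rw [← sum_Ico_int_sub h2 V, Finset.mul_sum]
    refine Finset.sum_congr rfl fun j hj => ?_
    rw [Finset.mem_Ico] at hj
    have : j / d = b := by
      rw [Int.ediv_eq_iff_of_pos hd]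
      constructor <;> nlinarith
    rw [this]

/-- Each coarse increment telescopes into `d` fine ones; the floor `j / d` is the coarse cell
containing the fine cell `j`. -/
theorem approxField_refine {Ω : Type*} (W : ℝ → Ω → ℂ) (s : ℝ) {N d : ℕ} (hd : 0 < d)
    (R : ℕ) (ω : Ω) (x : ℝ) : approxField W s N R ω x =
      ∑ j ∈ Finset.Ico (-(((N * d : ℕ) : ℤ) * R)) (((N * d : ℕ) : ℤ) * R),
        integrand s x (((j / (d : ℤ) : ℤ) : ℝ) / N) * incr W (N * d) j ω := by
  have hd' : (d : ℝ) ≠ 0 := by positivity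
  have h := sum_Ico_int_refine (a := -((N : ℤ) * R)) (b := (N : ℤ) * R)
    (by have : (0 : ℤ) ≤ (N : ℤ) * R := by positivity
        linarith) (d := d) (by exact_mod_cast hd)
    (fun q => integrand s x ((q : ℝ) / N)) (fun j => W ((j : ℝ) / (N * d : ℕ)) ω)
  rw [approxField_eq]
  have e1 : -((N : ℤ) * R) * d = -(((N * d : ℕ) : ℤ) * R) := by push_cast; ring
  have e2 : ((N : ℤ) * R) * d = ((N * d : ℕ) : ℤ) * R := by push_cast; ring
  rw [e1, e2] at h
  convert h using 3 with q _ j _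
  · rw [incr]
    push_cast
    rw [mul_div_mul_right _ _ hd', mul_div_mul_right _ _ hd']
  · rw [incr]
    push_cast
    rfl

/-- The constant comes from `y² ≤ 2z² + 2(z - y)² ≤ 2z² + 8`. -/
theorem one_add_sq_le_of_near {y z : ℝ} (h : |z - y| ≤ 2) : 1 + y ^ 2 ≤ 9 * (1 + z ^ 2) := by
  have h1 := abs_le.1 h
  nlinarith [sq_nonneg (z + (z - y)), sq_nonneg (z - y), mul_nonneg (sub_nonneg.2 h1.2) (by linarith [h1.1] : 0 ≤ (z - y) + 2)]

theorem rpow_le_of_near {s y z : ℝ} (hs : s ≤ 1) (h : |z - y| ≤ 2) :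
    (1 + z ^ 2) ^ ((s - 1) / 2) ≤ (9 : ℝ) ^ ((1 - s) / 2) * (1 + y ^ 2) ^ ((s - 1) / 2) := by
  have h1 := one_add_sq_le_of_near h
  calc (1 + z ^ 2) ^ ((s - 1) / 2) ≤ (9⁻¹ * (1 + y ^ 2)) ^ ((s - 1) / 2) :=
        Real.rpow_le_rpow_of_nonpos (by positivity) (by linarith) (by linarith)
    _ = _ := by
        rw [Real.mul_rpow (by norm_num) (by positivity), Real.inv_rpow (by norm_num),
          ← Real.rpow_neg (by norm_num)]
        congr 2
        ring

/-- Mean value inequality on the ball of radius `2` about `y`: there `|z| ≤ 1 + z²` bounds the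
derivative by a multiple of the function itself. -/
theorem abs_rpow_sub_le_of_near {s y n m : ℝ} (hs : s ≤ 1) (hn : |n - y| ≤ 2)
    (hm : |m - y| ≤ 2) : |(1 + n ^ 2) ^ ((s - 1) / 2) - (1 + m ^ 2) ^ ((s - 1) / 2)| ≤
      (1 - s) * ((9 : ℝ) ^ ((1 - s) / 2) * (1 + y ^ 2) ^ ((s - 1) / 2)) * |n - m| := by
  have hder : ∀ z ∈ Metric.closedBall y 2, HasDerivWithinAt
      (fun z : ℝ => (1 + z ^ 2) ^ ((s - 1) / 2))
      (2 * z * ((s - 1) / 2) * (1 + z ^ 2) ^ ((s - 1) / 2 - 1)) (Metric.closedBall y 2) z := by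
    intro z _
    have h0 : HasDerivAt (fun ξ : ℝ => 1 + ξ ^ 2) (2 * z) z := by
      have := ((hasDerivAt_id z).pow 2).const_add 1
      simpa using this
    exact (h0.rpow_const (Or.inl (by positivity))).hasDerivWithinAt
  have hbound : ∀ z ∈ Metric.closedBall y 2,
      ‖2 * z * ((s - 1) / 2) * (1 + z ^ 2) ^ ((s - 1) / 2 - 1)‖ ≤
        (1 - s) * ((9 : ℝ) ^ ((1 - s) / 2) * (1 + y ^ 2) ^ ((s - 1) / 2)) := by
    intro z hz
    rw [Metric.mem_closedBall, Real.dist_eq] at hz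
    have h1 : |z| ≤ 1 + z ^ 2 := by
      rw [abs_le]
      constructor <;> nlinarith [sq_nonneg (z - 1), sq_nonneg (z + 1)]
    have h2 : (1 + z ^ 2) * (1 + z ^ 2) ^ ((s - 1) / 2 - 1) = (1 + z ^ 2) ^ ((s - 1) / 2) := by
      calc (1 + z ^ 2) * (1 + z ^ 2) ^ ((s - 1) / 2 - 1)
          = (1 + z ^ 2) ^ (1 : ℝ) * (1 + z ^ 2) ^ ((s - 1) / 2 - 1) := by rw [Real.rpow_one]
        _ = _ := by
            rw [← Real.rpow_add (by positivity)]
            congr 1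
            ring
    have h3 : |s - 1| = 1 - s := by rw [abs_sub_comm, abs_of_nonneg (by linarith)]
    calc ‖2 * z * ((s - 1) / 2) * (1 + z ^ 2) ^ ((s - 1) / 2 - 1)‖
        = (1 - s) * (|z| * (1 + z ^ 2) ^ ((s - 1) / 2 - 1)) := by
          rw [Real.norm_eq_abs, show 2 * z * ((s - 1) / 2) = (s - 1) * z by ring, abs_mul, abs_mul,
            h3, abs_of_nonneg (a := (1 + z ^ 2) ^ ((s - 1) / 2 - 1)) (by positivity)]
          ring
      _ ≤ (1 - s) * ((1 + z ^ 2) * (1 + z ^ 2) ^ ((s - 1) / 2 - 1)) := by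
          have : 0 ≤ 1 - s := by linarith
          gcongr
      _ ≤ _ := by
          rw [h2]
          have : 0 ≤ 1 - s := by linarith
          gcongr
          exact rpow_le_of_near hs hz
  have := Convex.norm_image_sub_le_of_norm_hasDerivWithin_le hder hbound (convex_closedBall y 2)
    (x := m) (y := n) (by rwa [Metric.mem_closedBall, Real.dist_eq])
    (by rwa [Metric.mem_closedBall, Real.dist_eq])
  simpa only [Real.norm_eq_abs] using this

/-- Interpolation between the bounds `|θ|` and `2` for `|e^{iθ} - 1|`. An exponent below `1/2` is
needed for the square to be integrable in `x` against `(1 + x²)⁻¹`; `1/4` is a convenient choice. -/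
theorem norm_exp_sub_exp_le (n m x : ℝ) :
    ‖Complex.exp (Complex.I * n * x) - Complex.exp (Complex.I * m * x)‖ ≤
      2 * |(n - m) * x| ^ (1 / 4 : ℝ) := by
  have h1 : Complex.exp (Complex.I * n * x) - Complex.exp (Complex.I * m * x) =
      Complex.exp ((m * x : ℝ) * Complex.I) *
        (Complex.exp (Complex.I * ((n - m) * x : ℝ)) - 1) := by
    rw [mul_sub, mul_one, ← Complex.exp_add]
    congr 2 <;> push_cast <;> ring
  rw [h1, norm_mul, Complex.norm_exp_ofReal_mul_I, one_mul]
  set θ := (n - m) * x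
  rcases le_total |θ| 1 with h | h
  · calc ‖Complex.exp (Complex.I * (θ : ℝ)) - 1‖ ≤ |θ| := Real.norm_exp_I_mul_ofReal_sub_one_le
      _ = |θ| ^ (1 : ℝ) := (Real.rpow_one _).symm
      _ ≤ |θ| ^ (1 / 4 : ℝ) :=
        Real.rpow_le_rpow_of_exponent_ge' (abs_nonneg _) h (by norm_num) (by norm_num)
      _ ≤ 2 * |θ| ^ (1 / 4 : ℝ) := by
        have : 0 ≤ |θ| ^ (1 / 4 : ℝ) := by positivity
        linarith
  · calc ‖Complex.exp (Complex.I * (θ : ℝ)) - 1‖ ≤ 2 * 1 := by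
          refine (norm_sub_le _ _).trans ?_
          rw [mul_comm, Complex.norm_exp_ofReal_mul_I, norm_one]
          norm_num
      _ ≤ 2 * |θ| ^ (1 / 4 : ℝ) := by
          gcongr
          exact Real.one_le_rpow h (by norm_num)

/-- The constant of the Cauchy estimate. -/
def cauchyConst (s : ℝ) : ℝ := (3 - s) * (9 : ℝ) ^ ((1 - s) / 2)

theorem norm_integrand (s x n : ℝ) : ‖integrand s x n‖ = (1 + n ^ 2) ^ ((s - 1) / 2) := by
  rw [integrand, norm_mul, Complex.norm_real, Real.norm_of_nonneg (by positivity),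
    show Complex.I * n * x = ((n * x : ℝ) : ℂ) * Complex.I by push_cast; ring,
    Complex.norm_exp_ofReal_mul_I, mul_one]

theorem norm_integrand_sub_le {s y n m x δ : ℝ} (hs : s ≤ 1) (hn : |n - y| ≤ 2)
    (hm : |m - y| ≤ 2) (hδ : |n - m| ≤ δ) (hδ1 : δ ≤ 1) :
    ‖integrand s x n - integrand s x m‖ ≤
      cauchyConst s * δ ^ (1 / 4 : ℝ) * (1 + x ^ 2) ^ (1 / 8 : ℝ) *
        (1 + y ^ 2) ^ ((s - 1) / 2) := by
  have hδ0 : 0 ≤ δ := (abs_nonneg _).trans hδ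
  set H := (9 : ℝ) ^ ((1 - s) / 2) * (1 + y ^ 2) ^ ((s - 1) / 2) with hH
  have hH0 : 0 ≤ H := by positivity
  have hs' : 0 ≤ 1 - s := by linarith
  have hδ4 : δ ≤ δ ^ (1 / 4 : ℝ) := by
    calc δ = δ ^ (1 : ℝ) := (Real.rpow_one _).symm
      _ ≤ _ := Real.rpow_le_rpow_of_exponent_ge' hδ0 hδ1 (by norm_num) (by norm_num)
  have hx1 : 1 ≤ (1 + x ^ 2) ^ (1 / 8 : ℝ) :=
    Real.one_le_rpow (by nlinarith [sq_nonneg x]) (by norm_num)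
  have hx2 : |x| ^ (1 / 4 : ℝ) ≤ (1 + x ^ 2) ^ (1 / 8 : ℝ) := by
    calc |x| ^ (1 / 4 : ℝ) = (|x| ^ (2 : ℝ)) ^ (1 / 8 : ℝ) := by
          rw [← Real.rpow_mul (abs_nonneg _)]
          norm_num
      _ = (x ^ 2) ^ (1 / 8 : ℝ) := by rw [Real.rpow_two, sq_abs]
      _ ≤ _ := Real.rpow_le_rpow (by positivity) (by linarith) (by norm_num)
  have hdec : integrand s x n - integrand s x m =
      (((1 + n ^ 2) ^ ((s - 1) / 2) - (1 + m ^ 2) ^ ((s - 1) / 2) : ℝ) : ℂ) *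
        Complex.exp (Complex.I * n * x) + (((1 + m ^ 2) ^ ((s - 1) / 2) : ℝ) : ℂ) *
        (Complex.exp (Complex.I * n * x) - Complex.exp (Complex.I * m * x)) := by
    simp only [integrand]
    push_cast
    ring
  have hexp : ‖Complex.exp (Complex.I * n * x)‖ = 1 := by
    rw [show Complex.I * n * x = ((n * x : ℝ) : ℂ) * Complex.I by push_cast; ring,
      Complex.norm_exp_ofReal_mul_I]
  rw [hdec]
  refine (norm_add_le _ _).trans ?_
  rw [norm_mul, norm_mul, hexp, mul_one, Complex.norm_real, Complex.norm_real, Real.norm_eq_abs,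
    Real.norm_of_nonneg (by positivity)]
  have t1 := abs_rpow_sub_le_of_near hs hn hm
  have t2 := rpow_le_of_near hs hm
  have t3 := norm_exp_sub_exp_le n m x
  rw [abs_mul, Real.mul_rpow (abs_nonneg _) (abs_nonneg _)] at t3
  set E := δ ^ (1 / 4 : ℝ) * (1 + x ^ 2) ^ (1 / 8 : ℝ) with hE
  have hE0 : 0 ≤ E := by positivity
  have t4 : |n - m| ^ (1 / 4 : ℝ) * |x| ^ (1 / 4 : ℝ) ≤ E := by
    rw [hE]
    gcongr
  have t5 : |n - m| ≤ E := by
    calc |n - m| ≤ δ ^ (1 / 4 : ℝ) * 1 := by rw [mul_one]; exact hδ.trans hδ4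
      _ ≤ E := by rw [hE]; gcongr
  -- The amplitude contributes `1 - s` and the phase contributes `2`, whence the `3 - s` of
  -- `cauchyConst`.
  calc _ ≤ (1 - s) * H * E + H * (2 * E) := by
        refine add_le_add (t1.trans (by gcongr)) ?_
        refine mul_le_mul t2 (t3.trans (by gcongr)) (norm_nonneg _) hH0
    _ = _ := by
        rw [hE, hH, cauchyConst]
        ring

/-- The density of the bound for the squared distance between the approximating fields. -/
def cauchyDensity (s : ℝ) (k : ℕ) (y : ℝ) : ℝ :=
  cauchyConst s ^ 2 * (((2 : ℝ) ^ k)⁻¹ ^ (1 / 2 : ℝ) + {y : ℝ | (k : ℝ) ≤ |y|}.indicator 1 y) *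
    (1 + y ^ 2) ^ (s - 1)

theorem measurable_cauchyDensity (s : ℝ) (k : ℕ) : Measurable (cauchyDensity s k) := by
  have hS : MeasurableSet {y : ℝ | (k : ℝ) ≤ |y|} :=
    measurableSet_le measurable_const continuous_abs.measurable
  have h1 : Measurable ({y : ℝ | (k : ℝ) ≤ |y|}.indicator (1 : ℝ → ℝ)) :=
    measurable_const.indicator hS
  have h2 : Measurable fun y : ℝ => (1 + y ^ 2) ^ (s - 1) := by fun_prop
  exact ((h1.const_add _).const_mul _).mul h2

theorem rpow_half_sq {a : ℝ} (ha : 0 ≤ a) (r : ℝ) : (a ^ (r / 2)) ^ 2 = a ^ r := by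
  rw [← Real.rpow_natCast, ← Real.rpow_mul ha]
  congr 1
  push_cast
  ring

/-- The coefficient of the increment over `[j/2^k', (j+1)/2^k']` in `F_{k'} - F_k`. -/
def coeffDiff (s x : ℝ) (k k' : ℕ) (j : ℤ) : ℂ :=
  integrand s x ((j : ℝ) / (2 ^ k' : ℕ)) -
    if j ∈ Finset.Ico (-(((2 ^ k' : ℕ) : ℤ) * k)) (((2 ^ k' : ℕ) : ℤ) * k) then
      integrand s x (((j / ((2 ^ (k' - k) : ℕ) : ℤ) : ℤ) : ℝ) / (2 ^ k : ℕ)) else 0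

/-- There are two sources of error, one for each summand in `cauchyDensity`. Inside the range of
`φ_{2^k,k}` the nodes differ by at most `2^{-k}`; outside it the coarse coefficient is absent and
the whole cell lies in `|y| ≥ k`. -/
theorem norm_coeffDiff_sq_le {s : ℝ} (hs : s ≤ 1) (x : ℝ) {k k' : ℕ} (hk : k ≤ k') (j : ℤ)
    {y : ℝ} (hy : y ∈ Set.Ico ((j : ℝ) / (2 ^ k' : ℕ)) (((j : ℝ) + 1) / (2 ^ k' : ℕ))) :
    ‖coeffDiff s x k k' j‖ ^ 2 ≤ (1 + x ^ 2) ^ (1 / 4 : ℝ) * cauchyDensity s k y := by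
  have hM : (0 : ℝ) < (2 ^ k' : ℕ) := by positivity
  have hM1 : (1 : ℝ) ≤ (2 ^ k' : ℕ) := by exact_mod_cast Nat.one_le_two_pow
  have hN1 : (1 : ℝ) ≤ (2 ^ k : ℕ) := by exact_mod_cast Nat.one_le_two_pow
  have hN : (0 : ℝ) < (2 ^ k : ℕ) := by positivity
  set n : ℝ := (j : ℝ) / (2 ^ k' : ℕ) with hn
  have hny : |n - y| ≤ 1 := by
    have h1 := hy.1
    have h2 := hy.2
    have h3 : ((j : ℝ) + 1) / (2 ^ k' : ℕ) ≤ n + 1 := by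
      rw [hn, add_div]
      gcongr
      exact div_le_one_of_le₀ hM1 hM.le
    rw [abs_le]
    constructor <;> linarith
  have hpow : ((1 + y ^ 2) ^ ((s - 1) / 2)) ^ 2 = (1 + y ^ 2) ^ (s - 1) :=
    rpow_half_sq (by positivity) _
  have hxpow : (((1 + x ^ 2) ^ (1 / 8 : ℝ))) ^ 2 = (1 + x ^ 2) ^ (1 / 4 : ℝ) := by
    rw [← rpow_half_sq (by positivity : (0 : ℝ) ≤ 1 + x ^ 2) (1 / 4)]
    norm_num
  have hc : (9 : ℝ) ^ ((1 - s) / 2) ≤ cauchyConst s := by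
    rw [cauchyConst]
    exact le_mul_of_one_le_left (by positivity) (by linarith)
  have hx1 : 1 ≤ (1 + x ^ 2) ^ (1 / 4 : ℝ) :=
    Real.one_le_rpow (by nlinarith [sq_nonneg x]) (by norm_num)
  have hind : (0 : ℝ) ≤ {y : ℝ | (k : ℝ) ≤ |y|}.indicator 1 y :=
    Set.indicator_nonneg (fun _ _ => zero_le_one) _
  rw [coeffDiff]
  split_ifs with hj
  · set d : ℤ := ((2 ^ (k' - k) : ℕ) : ℤ) with hd
    have hd0 : (0 : ℤ) < d := by positivity
    have hd0' : (0 : ℝ) < d := by exact_mod_cast hd0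
    have hMd : ((2 ^ k' : ℕ) : ℝ) = (2 ^ k : ℕ) * (d : ℝ) := by
      rw [hd]
      push_cast
      rw [← pow_add, Nat.add_sub_cancel' hk]
    set m : ℝ := ((j / d : ℤ) : ℝ) / (2 ^ k : ℕ) with hm
    have hq1 : ((j / d : ℤ) : ℝ) * d ≤ j := by exact_mod_cast Int.ediv_mul_le j hd0.ne'
    have hq2 : (j : ℝ) < (((j / d : ℤ) : ℝ) + 1) * d := by
      exact_mod_cast Int.lt_ediv_add_one_mul_self j hd0
    have hnm : n - m = ((j : ℝ) - ((j / d : ℤ) : ℝ) * d) / d * ((2 : ℝ) ^ k)⁻¹ := by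
      rw [hn, hm, hMd]
      push_cast
      field_simp
    have hδ : |n - m| ≤ ((2 : ℝ) ^ k)⁻¹ := by
      rw [hnm, abs_of_nonneg (mul_nonneg (div_nonneg (by linarith) hd0'.le) (by positivity))]
      refine mul_le_of_le_one_left (by positivity) ?_
      rw [div_le_one hd0']
      linarith
    have hδ1 : ((2 : ℝ) ^ k)⁻¹ ≤ 1 := inv_le_one_of_one_le₀ (one_le_pow₀ (by norm_num))
    -- The fine node is within `1` of `y` and the coarse node within `1` of the fine one; this fixes
    -- the radius `2` of the preceding estimates.
    have hmy : |m - y| ≤ 2 := by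
      have : |m - y| ≤ |n - m| + |n - y| := by
        rw [abs_sub_comm n m]
        calc |m - y| = |(m - n) + (n - y)| := by ring_nf
          _ ≤ _ := abs_add_le _ _
      linarith
    have hb := norm_integrand_sub_le (x := x) hs (by linarith) hmy hδ hδ1
    calc ‖integrand s x n - integrand s x m‖ ^ 2 ≤ (cauchyConst s * ((2 : ℝ) ^ k)⁻¹ ^ (1 / 4 : ℝ) *
          (1 + x ^ 2) ^ (1 / 8 : ℝ) * (1 + y ^ 2) ^ ((s - 1) / 2)) ^ 2 := by gcongr
      _ = (1 + x ^ 2) ^ (1 / 4 : ℝ) * (cauchyConst s ^ 2 *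
          (((2 : ℝ) ^ k)⁻¹ ^ (1 / 2 : ℝ) + 0) * (1 + y ^ 2) ^ (s - 1)) := by
          rw [← hxpow, ← hpow, ← rpow_half_sq (by positivity : (0 : ℝ) ≤ ((2 : ℝ) ^ k)⁻¹) (1 / 2)]
          norm_num
          ring
      _ ≤ _ := by
          rw [cauchyDensity]
          gcongr
  · have hyk : (k : ℝ) ≤ |y| := by
      have hjk : j < -(((2 ^ k' : ℕ) : ℤ) * k) ∨ ((2 ^ k' : ℕ) : ℤ) * k ≤ j := by
        rw [Finset.mem_Ico] at hj
        omega
      rcases hjk with h | h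
      · have h1 : (j : ℝ) + 1 ≤ -((2 ^ k' : ℕ) * (k : ℝ)) := by exact_mod_cast h
        have h2 : y < -(k : ℝ) := by
          refine hy.2.trans_le ?_
          rw [div_le_iff₀ hM]
          linarith
        rw [le_abs]
        right
        linarith
      · have h1 : (2 ^ k' : ℕ) * (k : ℝ) ≤ j := by exact_mod_cast h
        refine le_trans ?_ (le_abs_self y)
        refine le_trans ?_ hy.1
        rw [le_div_iff₀ hM]
        linarith
    rw [sub_zero, norm_integrand]
    have h1 := rpow_le_of_near hs (hny.trans one_le_two)
    have h0 : (0 : ℝ) ≤ ((2 : ℝ) ^ k)⁻¹ ^ (1 / 2 : ℝ) := by positivity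
    calc ((1 + n ^ 2) ^ ((s - 1) / 2)) ^ 2
        ≤ (cauchyConst s * (1 + y ^ 2) ^ ((s - 1) / 2)) ^ 2 := by
          gcongr
          exact h1.trans (by gcongr)
      _ = 1 * (cauchyConst s ^ 2 * (0 + 1) * (1 + y ^ 2) ^ (s - 1)) := by
          rw [← hpow]
          ring
      _ ≤ _ := by
          rw [cauchyDensity, Set.indicator_of_mem (show y ∈ {y : ℝ | (k : ℝ) ≤ |y|} from hyk)]
          simp only [Pi.one_apply]
          gcongr

/-- The size of the error of the `k`-th approximating field. -/
def cauchyErr (s : ℝ) (k : ℕ) : ℝ≥0∞ := ∫⁻ y, ENNReal.ofReal (cauchyDensity s k y)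

theorem tendsto_cauchyErr {s : ℝ} (hs : s < 1 / 2) : Tendsto (cauchyErr s) atTop (𝓝 0) := by
  have hint : Integrable (fun y : ℝ => cauchyConst s ^ 2 * 2 * (1 + y ^ 2) ^ (s - 1)) := by
    -- Integrability in dimension one requires `2(1 - s) > 1`, which is exactly `s < 1/2`.
    have h := integrable_rpow_neg_one_add_norm_sq (E := ℝ) (μ := volume) (r := 2 * (1 - s))
      (by simp; linarith)
    refine (h.const_mul (cauchyConst s ^ 2 * 2)).congr (Eventually.of_forall fun y => ?_)
    simp only [Real.norm_eq_abs, sq_abs]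
    congr 2
    ring
  have hbound : ∀ k y, cauchyDensity s k y ≤ cauchyConst s ^ 2 * 2 * (1 + y ^ 2) ^ (s - 1) := by
    intro k y
    have h1 : {y : ℝ | (k : ℝ) ≤ |y|}.indicator (1 : ℝ → ℝ) y ≤ 1 :=
      Set.indicator_le_self' (fun _ _ => zero_le_one) y
    have h2 : ((2 : ℝ) ^ k)⁻¹ ^ (1 / 2 : ℝ) ≤ 1 :=
      Real.rpow_le_one (by positivity) (inv_le_one_of_one_le₀ (one_le_pow₀ (by norm_num)))
        (by norm_num)
    rw [cauchyDensity]
    gcongr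
    linarith
  have hlim := tendsto_lintegral_of_dominated_convergence (μ := volume)
    (F := fun k y => ENNReal.ofReal (cauchyDensity s k y)) (f := fun _ => 0)
    (fun y => ENNReal.ofReal (cauchyConst s ^ 2 * 2 * (1 + y ^ 2) ^ (s - 1)))
    (fun k => (measurable_cauchyDensity s k).ennreal_ofReal)
    (fun k => Eventually.of_forall fun y => ENNReal.ofReal_le_ofReal (hbound k y))
    hint.lintegral_lt_top.ne
    (Eventually.of_forall fun y => by
      have h1 : Tendsto (fun k : ℕ => ((2 : ℝ) ^ k)⁻¹ ^ (1 / 2 : ℝ)) atTop (𝓝 0) := by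
        have h := (tendsto_pow_atTop_nhds_zero_of_lt_one (r := (2 : ℝ)⁻¹) (by norm_num)
          (by norm_num)).rpow_const (p := 1 / 2) (Or.inr (by norm_num))
        simpa [inv_pow] using h
      have h2 : Tendsto (fun k : ℕ => {y : ℝ | (k : ℝ) ≤ |y|}.indicator (1 : ℝ → ℝ) y) atTop
          (𝓝 0) := by
        obtain ⟨K, hK⟩ := exists_nat_gt |y|
        refine tendsto_const_nhds.congr' ?_
        filter_upwards [eventually_ge_atTop K] with k hk
        have : (K : ℝ) ≤ k := by exact_mod_cast hk
        rw [Set.indicator_of_notMem]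
        simp only [Set.mem_ofPred_eq, not_le]
        linarith
      have h3 := (((h1.add h2).const_mul (cauchyConst s ^ 2)).mul_const ((1 + y ^ 2) ^ (s - 1)))
      have h4 := ENNReal.tendsto_ofReal h3
      simpa [cauchyDensity] using h4)
  rw [lintegral_zero] at hlim
  exact hlim

/-- The cells are disjoint of length `2^{-k'}`, and the coefficient bound holds at every point of
its cell, so the sum is at most an integral that depends neither on `k'` nor on `S`. -/
theorem ofReal_sum_coeffDiff_le {s : ℝ} (hs : s ≤ 1) (x : ℝ) {k k' : ℕ} (hk : k ≤ k')
    (S : Finset ℤ) :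
    ENNReal.ofReal (∑ j ∈ S, ‖coeffDiff s x k k' j‖ ^ 2 * ((2 ^ k' : ℕ) : ℝ)⁻¹) ≤
      ENNReal.ofReal ((1 + x ^ 2) ^ (1 / 4 : ℝ)) * cauchyErr s k := by
  have hM : (0 : ℝ) < (2 ^ k' : ℕ) := by positivity
  let I : ℤ → Set ℝ := fun j => Set.Ico ((j : ℝ) / (2 ^ k' : ℕ)) (((j : ℝ) + 1) / (2 ^ k' : ℕ))
  have hfloor : ∀ {j : ℤ} {y : ℝ}, y ∈ I j → ⌊y * (2 ^ k' : ℕ)⌋ = j := by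
    intro j y hy
    rw [Int.floor_eq_iff]
    exact ⟨(div_le_iff₀ hM).1 hy.1, (lt_div_iff₀ hM).1 hy.2⟩
  have hdisj : (S : Set ℤ).PairwiseDisjoint I := by
    intro i _ j _ hij
    rw [Function.onFun, Set.disjoint_left]
    intro y hi hj
    exact hij ((hfloor hi).symm.trans (hfloor hj))
  have hvol : ∀ j, volume (I j) = ENNReal.ofReal ((2 ^ k' : ℕ) : ℝ)⁻¹ := by
    intro j
    simp only [I]
    rw [Real.volume_Ico, ← sub_div]
    simp
  rw [ENNReal.ofReal_sum_of_nonneg fun j _ => by positivity]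
  calc ∑ j ∈ S, ENNReal.ofReal (‖coeffDiff s x k k' j‖ ^ 2 * ((2 ^ k' : ℕ) : ℝ)⁻¹)
      = ∑ j ∈ S, ∫⁻ _ in I j, ENNReal.ofReal (‖coeffDiff s x k k' j‖ ^ 2) := by
        refine Finset.sum_congr rfl fun j _ => ?_
        rw [setLIntegral_const, hvol, ENNReal.ofReal_mul (by positivity)]
    _ ≤ ∑ j ∈ S, ∫⁻ y in I j, ENNReal.ofReal ((1 + x ^ 2) ^ (1 / 4 : ℝ)) *
          ENNReal.ofReal (cauchyDensity s k y) := by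
        refine Finset.sum_le_sum fun j _ => setLIntegral_mono' measurableSet_Ico fun y hy => ?_
        rw [← ENNReal.ofReal_mul (by positivity)]
        exact ENNReal.ofReal_le_ofReal (norm_coeffDiff_sq_le hs x hk j hy)
    _ = ∫⁻ y in ⋃ j ∈ S, I j, ENNReal.ofReal ((1 + x ^ 2) ^ (1 / 4 : ℝ)) *
          ENNReal.ofReal (cauchyDensity s k y) :=
        (lintegral_biUnion_finset hdisj (fun j _ => measurableSet_Ico) _).symm
    _ ≤ ∫⁻ y, ENNReal.ofReal ((1 + x ^ 2) ^ (1 / 4 : ℝ)) *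
          ENNReal.ofReal (cauchyDensity s k y) := setLIntegral_le_lintegral _ _
    _ = _ := by
        rw [lintegral_const_mul _ (measurable_cauchyDensity s k).ennreal_ofReal, cauchyErr]

theorem approxField_sub {Ω : Type*} (W : ℝ → Ω → ℂ) (s : ℝ) {k k' : ℕ} (hk : k ≤ k') (ω : Ω)
    (x : ℝ) : approxField W s (2 ^ k') k' ω x - approxField W s (2 ^ k) k ω x =
      ∑ j ∈ Finset.Ico (-(((2 ^ k' : ℕ) : ℤ) * k')) (((2 ^ k' : ℕ) : ℤ) * k'),
        coeffDiff s x k k' j * incr W (2 ^ k') j ω := by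
  have hMd : 2 ^ k * 2 ^ (k' - k) = 2 ^ k' := by rw [← pow_add, Nat.add_sub_cancel' hk]
  have hsub : Finset.Ico (-(((2 ^ k' : ℕ) : ℤ) * k)) (((2 ^ k' : ℕ) : ℤ) * k) ⊆
      Finset.Ico (-(((2 ^ k' : ℕ) : ℤ) * k')) (((2 ^ k' : ℕ) : ℤ) * k') := by
    have : ((2 ^ k' : ℕ) : ℤ) * k ≤ ((2 ^ k' : ℕ) : ℤ) * k' := by gcongr
    exact Finset.Ico_subset_Ico (by linarith) this
  rw [approxField_refine W s (N := 2 ^ k) (d := 2 ^ (k' - k)) (by positivity) k ω x, hMd,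
    approxField_eq]
  simp only [coeffDiff, sub_mul, Finset.sum_sub_distrib, ite_mul, zero_mul]
  rw [Finset.sum_ite_mem, Finset.inter_eq_right.2 hsub]

/-- The approximating fields form a Cauchy sequence. -/
theorem IsComplexBrownian.lintegral_approxField_sub_le {Ω : Type*} [MeasurableSpace Ω]
    {P : Measure Ω} {W : ℝ → Ω → ℂ} (hW : IsComplexBrownian W P) {s : ℝ} (hs : s < 1 / 2)
    {k k' : ℕ} (hk : k ≤ k') (x : ℝ) :
    ∫⁻ ω, ‖approxField W s (2 ^ k') k' ω x - approxField W s (2 ^ k) k ω x‖ₑ ^ 2 ∂P ≤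
      ENNReal.ofReal ((1 + x ^ 2) ^ (1 / 4 : ℝ)) * cauchyErr s k := by
  simp only [approxField_sub W s hk]
  rw [hW.lintegral_enorm_sq_sum_incr]
  exact ofReal_sum_coeffDiff_le (by linarith) x hk _

/-! ### The limit of the approximating fields -/

theorem eLpNorm_two_sq {α : Type*} [MeasurableSpace α] (μ : Measure α) (f : α → ℂ) :
    eLpNorm f 2 μ ^ 2 = ∫⁻ a, ‖f a‖ₑ ^ 2 ∂μ := by
  have h := eLpNorm_nnreal_pow_eq_lintegral (μ := μ) (f := f) (p := 2) (by norm_num)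
  simpa only [NNReal.coe_ofNat, ENNReal.coe_ofNat, ENNReal.rpow_ofNat] using h

/-- The integral of `(1 + x²)^{-3/4}`. -/
def wtConst : ℝ≥0∞ := ∫⁻ x : ℝ, ENNReal.ofReal ((1 + x ^ 2) ^ (-(3 / 4) : ℝ))

theorem wtConst_ne_top : wtConst ≠ ∞ := by
  have h := (integrable_rpow_neg_one_add_norm_sq (E := ℝ) (μ := volume) (r := 3 / 2)
    (by norm_num)).lintegral_lt_top
  refine ne_of_lt (lt_of_le_of_lt (le_of_eq ?_) h)
  refine lintegral_congr fun x => ?_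
  rw [Real.norm_eq_abs, sq_abs]
  norm_num

theorem enorm_wt_inv_sq_mul (x : ℝ) :
    ‖(wt x)⁻¹‖ₑ ^ 2 * ENNReal.ofReal ((1 + x ^ 2) ^ (1 / 4 : ℝ)) =
      ENNReal.ofReal ((1 + x ^ 2) ^ (-(3 / 4) : ℝ)) := by
  rw [← ofReal_norm, ← ENNReal.ofReal_pow (norm_nonneg _),
    ← ENNReal.ofReal_mul (by positivity), norm_inv, inv_pow, norm_wt_sq, ← Real.rpow_neg_one,
    ← Real.rpow_add (by positivity)]
  norm_num

section

variable {Ω : Type*} [MeasurableSpace Ω] {P : Measure Ω} {W : ℝ → Ω → ℂ}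

theorem IsComplexBrownian.measurable_approxField (hW : IsComplexBrownian W P) (s : ℝ) (N R : ℕ) :
    Measurable (Function.uncurry (approxField W s N R)) := by
  have : Function.uncurry (approxField W s N R) = fun p : Ω × ℝ =>
      ∑ k ∈ Finset.Ico (-((N : ℤ) * R)) ((N : ℤ) * R),
        integrand s p.2 ((k : ℝ) / N) * incr W N k p.1 := by
    ext p
    exact approxField_eq W s N R p.1 p.2
  rw [this]
  refine Finset.measurable_sum _ fun k _ => Measurable.mul ?_ ?_
  · unfold integrand
    fun_prop
  · exact (hW.measurable_incr N k).comp measurable_fst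

theorem lintegral_lintegral_weighted_le [SFinite P] {H : Ω → ℝ → ℂ}
    (hH : Measurable (Function.uncurry H)) {ε : ℝ≥0∞}
    (h : ∀ᵐ x, ∫⁻ ω, ‖H ω x‖ₑ ^ 2 ∂P ≤ ENNReal.ofReal ((1 + x ^ 2) ^ (1 / 4 : ℝ)) * ε) :
    ∫⁻ x, ∫⁻ ω, ‖(wt x)⁻¹ * H ω x‖ₑ ^ 2 ∂P ≤ wtConst * ε := by
  rw [wtConst, ← lintegral_mul_const _ (by fun_prop)]
  refine lintegral_mono_ae ?_
  filter_upwards [h] with x hx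
  have hm : Measurable fun ω => ‖H ω x‖ₑ ^ 2 :=
    ((hH.comp (measurable_id.prodMk measurable_const)).enorm).pow_const 2
  simp only [enorm_mul, mul_pow]
  rw [lintegral_const_mul _ hm, ← enorm_wt_inv_sq_mul, mul_assoc]
  gcongr

/-- A sequence that converges fast in a weighted `L²` space converges almost everywhere to a jointly
measurable field. -/
theorem exists_ae_tendsto_of_cauchy [SFinite P] {A : ℕ → Ω → ℝ → ℂ}
    (hA : ∀ j, Measurable (Function.uncurry (A j)))
    (hc : ∀ n m, n ≤ m → ∫⁻ x, ∫⁻ ω, ‖(wt x)⁻¹ * (A m ω x - A n ω x)‖ₑ ^ 2 ∂P <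
      ((1 / 2 : ℝ≥0∞) ^ n) ^ 2) :
    ∃ G : Ω → ℝ → ℂ, Measurable (Function.uncurry G) ∧
      ∀ᵐ x, ∀ᵐ ω ∂P, Tendsto (fun j => A j ω x) atTop (𝓝 (G ω x)) := by
  let f : ℕ → ℝ × Ω → ℂ := fun j p => (wt p.1)⁻¹ * A j p.2 p.1
  have hwm : Measurable fun x => (wt x)⁻¹ := (continuous_wt.inv₀ wt_ne_zero).measurable
  have hf : ∀ j, Measurable (f j) := fun j =>
    (hwm.comp measurable_fst).mul ((hA j).comp measurable_swap)
  have hle : ∀ n m, n ≤ m → eLpNorm (f m - f n) 2 (volume.prod P) < (1 / 2 : ℝ≥0∞) ^ n := by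
    intro n m hnm
    rw [← ENNReal.pow_lt_pow_left_iff two_ne_zero, eLpNorm_two_sq,
      lintegral_prod _ (((hf m).sub (hf n)).enorm.pow_const 2).aemeasurable]
    refine lt_of_eq_of_lt ?_ (hc n m hnm)
    simp only [Pi.sub_apply, f, ← mul_sub]
  have hmono : ∀ N n, N ≤ n → (1 / 2 : ℝ≥0∞) ^ n ≤ (1 / 2 : ℝ≥0∞) ^ N := fun N n h =>
    pow_le_pow_right_of_le_one' (by simp) h
  have hcau := Lp.ae_tendsto_of_cauchy_eLpNorm (p := 2) (μ := volume.prod P) (f := f)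
    (fun j => (hf j).aestronglyMeasurable) (by norm_num) (B := fun n => (1 / 2 : ℝ≥0∞) ^ n)
    (by
      rw [ENNReal.tsum_geometric]
      simp)
    (by
      intro N n m hn hm
      rcases le_total n m with h | h
      · rw [← eLpNorm_neg, neg_sub]
        exact (hle n m h).trans_le (hmono N n hn)
      · exact (hle m n h).trans_le (hmono N m hm))
  obtain ⟨g, hg, hg'⟩ := measurable_limit_of_tendsto_metrizable_ae
    (fun j => (hf j).aemeasurable) hcau
  refine ⟨fun ω x => wt x * g (x, ω), ?_, ?_⟩
  · exact (continuous_wt.measurable.comp measurable_snd).mul (hg.comp measurable_swap)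
  filter_upwards [Measure.ae_ae_of_ae_prod hg'] with x hx
  filter_upwards [hx] with ω hω
  refine (hω.const_mul (wt x)).congr fun j => ?_
  simp only [f, mul_inv_cancel_left₀ (wt_ne_zero x)]

/-- The fields `D^s φ_{2^k,k}` converge to a jointly measurable field. -/
theorem IsComplexBrownian.exists_limit [IsProbabilityMeasure P] (hW : IsComplexBrownian W P)
    {s : ℝ} (hs : s < 1 / 2) : ∃ G : Ω → ℝ → ℂ, Measurable (Function.uncurry G) ∧
      ∀ k, ∀ᵐ x, ∫⁻ ω, ‖G ω x - approxField W s (2 ^ k) k ω x‖ₑ ^ 2 ∂P ≤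
        ENNReal.ofReal ((1 + x ^ 2) ^ (1 / 4 : ℝ)) * cauchyErr s k := by
  have hlim : Tendsto (fun k => wtConst * cauchyErr s k) atTop (𝓝 0) := by
    simpa using ENNReal.Tendsto.const_mul (tendsto_cauchyErr hs) (Or.inr wtConst_ne_top)
  obtain ⟨κ, hκ, hκ'⟩ := extraction_forall_of_eventually
    (P := fun j k => wtConst * cauchyErr s k < ((1 / 2 : ℝ≥0∞) ^ j) ^ 2) fun j =>
      hlim.eventually_lt_const (ENNReal.pow_pos (ENNReal.pow_pos (by simp) _) _)
  have hA : ∀ N R, Measurable (Function.uncurry (approxField W s N R)) :=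
    hW.measurable_approxField s
  obtain ⟨G, hG, hG'⟩ := exists_ae_tendsto_of_cauchy (P := P)
    (A := fun j => approxField W s (2 ^ κ j) (κ j)) (fun j => hA _ _) fun n m hnm =>
      (lintegral_lintegral_weighted_le (H := fun ω x => approxField W s (2 ^ κ m) (κ m) ω x -
        approxField W s (2 ^ κ n) (κ n) ω x) ((hA _ _).sub (hA _ _)) (Eventually.of_forall fun x =>
          hW.lintegral_approxField_sub_le hs (hκ.monotone hnm) x)).trans_lt (hκ' n)
  refine ⟨G, hG, fun k => ?_⟩
  filter_upwards [hG'] with x hx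
  have hAx : ∀ N R, Measurable fun ω => approxField W s N R ω x := fun N R =>
    (hA N R).of_uncurry_right
  calc ∫⁻ ω, ‖G ω x - approxField W s (2 ^ k) k ω x‖ₑ ^ 2 ∂P
      -- Fatou's lemma transfers the Cauchy bound from the subsequence to its limit, for every `k`.
      = ∫⁻ ω, liminf (fun j => ‖approxField W s (2 ^ κ j) (κ j) ω x -
          approxField W s (2 ^ k) k ω x‖ₑ ^ 2) atTop ∂P := by
        refine lintegral_congr_ae ?_
        filter_upwards [hx] with ω hω
        refine (Tendsto.liminf_eq ?_).symm
        exact ((ENNReal.continuous_pow 2).tendsto _).comp (hω.sub_const _).enorm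
    _ ≤ liminf (fun j => ∫⁻ ω, ‖approxField W s (2 ^ κ j) (κ j) ω x -
          approxField W s (2 ^ k) k ω x‖ₑ ^ 2 ∂P) atTop :=
        lintegral_liminf_le fun j => ((hAx _ _).sub (hAx _ _)).enorm.pow_const 2
    _ ≤ _ := by
        refine liminf_le_of_frequently_le' (Eventually.frequently ?_)
        filter_upwards [hκ.tendsto_atTop.eventually_ge_atTop k] with j hj
        exact hW.lintegral_approxField_sub_le hs hj x

/-- The squared weight `(1 + x²)⁻¹` dominates the growth `(1 + x²)^{1/4}`, so the square root of
`cauchyErr` bounds the norm. -/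
theorem tendsto_essSup_of_lintegral_le {s : ℝ} (hs : s < 1 / 2) {G : Ω → ℝ → ℂ}
    (h : ∀ k, ∀ᵐ x, ∫⁻ ω, ‖G ω x - approxField W s (2 ^ k) k ω x‖ₑ ^ 2 ∂P ≤
      ENNReal.ofReal ((1 + x ^ 2) ^ (1 / 4 : ℝ)) * cauchyErr s k) :
    Tendsto (fun k : ℕ => essSup (fun x : ℝ => ENNReal.ofReal ((1 + x ^ 2) ^ (-(1 / 2) : ℝ)) *
      eLpNorm (fun ω => G ω x - approxField W s (2 ^ k) k ω x) 2 P) volume) atTop (𝓝 0) := by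
  have hlim : Tendsto (fun k => cauchyErr s k ^ (1 / 2 : ℝ)) atTop (𝓝 0) := by
    simpa using (tendsto_cauchyErr hs).ennrpow_const (1 / 2)
  refine tendsto_of_tendsto_of_tendsto_of_le_of_le tendsto_const_nhds hlim (fun _ => zero_le)
    fun k => essSup_le_of_ae_le _ ?_
  filter_upwards [h k] with x hx
  rw [← ENNReal.pow_le_pow_left_iff two_ne_zero, mul_pow, eLpNorm_two_sq,
    ← ENNReal.rpow_natCast (cauchyErr s k ^ (1 / 2 : ℝ)), ← ENNReal.rpow_mul]
  norm_num
  refine (mul_le_mul_right hx _).trans ?_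
  rw [← mul_assoc, ← ENNReal.ofReal_pow (by positivity), ← ENNReal.ofReal_mul (by positivity),
    ← Real.rpow_natCast, ← Real.rpow_mul (by positivity), ← Real.rpow_add (by positivity)]
  refine mul_le_of_le_one_left' ?_
  rw [ENNReal.ofReal_le_one]
  exact Real.rpow_le_one_of_one_le_of_nonpos (by nlinarith [sq_nonneg x]) (by norm_num)

/-- Diagonal extraction: the `j`-th index makes the means for all `l ≤ j` smaller than `2^{-j}`. For
fixed `l` the tail from `j = l` on has a finite expected sum, hence tends to `0` almost surely. -/
theorem exists_strictMono_ae_tendsto_zero {X : ℕ → ℕ → Ω → ℝ≥0∞}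
    (hX : ∀ l k, Measurable (X l k)) (h : ∀ l, Tendsto (fun k => ∫⁻ ω, X l k ω ∂P) atTop (𝓝 0)) :
    ∃ κ : ℕ → ℕ, StrictMono κ ∧ ∀ᵐ ω ∂P, ∀ l, Tendsto (fun j => X l (κ j) ω) atTop (𝓝 0) := by
  obtain ⟨κ, hκ, hκ'⟩ := extraction_forall_of_eventually
    (P := fun j k => ∀ l ∈ Finset.range (j + 1), ∫⁻ ω, X l k ω ∂P < (1 / 2 : ℝ≥0∞) ^ j) fun j =>
      (Finset.eventually_all _).2 fun l _ => (h l).eventually_lt_const (ENNReal.pow_pos (by simp) _)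
  refine ⟨κ, hκ, ae_all_iff.2 fun l => ?_⟩
  have hsum : ∫⁻ ω, ∑' j, X l (κ (j + l)) ω ∂P ≠ ∞ := by
    rw [lintegral_tsum fun j => (hX _ _).aemeasurable]
    refine ne_top_of_le_ne_top ?_ (ENNReal.tsum_le_tsum
      (g := fun j => (1 / 2 : ℝ≥0∞) ^ j) fun j => ?_)
    · rw [ENNReal.tsum_geometric]
      simp
    · refine (hκ' (j + l) l (by simp)).le.trans ?_
      exact pow_le_pow_right_of_le_one' (by simp) (by omega)
  filter_upwards [ae_lt_top' (Measurable.tsum fun j => hX _ _).aemeasurable hsum]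
    with ω hω
  exact (tendsto_add_atTop_iff_nat l).1 (ENNReal.tendsto_atTop_zero_of_tsum_ne_top hω.ne)

end

/-! ### Superpositions of waves in the weighted space -/

theorem memLp_wave (n : ℝ) :
    MemLp (fun x : ℝ => (wt x)⁻¹ * Complex.exp (Complex.I * n * x)) 2 volume := by
  have hm : AEStronglyMeasurable (fun x : ℝ => (wt x)⁻¹ * Complex.exp (Complex.I * n * x))
      volume := by
    have h := continuous_wt.inv₀ wt_ne_zero
    exact (h.mul (by fun_prop)).aestronglyMeasurable
  rw [memLp_two_iff_integrable_sq_norm hm]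
  refine integrable_inv_one_add_sq.congr (Eventually.of_forall fun x => ?_)
  have : ‖Complex.exp (Complex.I * n * x)‖ = 1 := by
    rw [← Complex.norm_exp_ofReal_mul_I (n * x)]
    congr 2
    push_cast
    ring
  simp only [norm_mul, norm_inv, this, mul_one, inv_pow, norm_wt_sq]

/-- The function `w⁻¹ exp (i n x)`. -/
def waveL2 (n : ℝ) : L2 := (memLp_wave n).toLp _

theorem coeFn_waveL2 (n : ℝ) :
    waveL2 n =ᵐ[volume] fun x => (wt x)⁻¹ * Complex.exp (Complex.I * n * x) :=
  (memLp_wave n).coeFn_toLp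

theorem wtDist_waveL2 (n : ℝ) : wtDist (waveL2 n) = planeWave n := by
  ext ψ
  rw [wtDist_apply, planeWave_apply]
  refine integral_congr_ae ?_
  filter_upwards [coeFn_waveL2 n] with x hx
  rw [hx, mul_inv_cancel_left₀ (wt_ne_zero x), mul_comm]

theorem linFlow_planeWave (t n : ℝ) :
    linFlow t (planeWave n) = flowSymbol t (n / (2 * Real.pi)) • planeWave n := by
  ext ψ
  change (𝓕⁻ (𝓕 (SchwartzMap.smulLeftCLM ℂ (flowSymbol t) (𝓕⁻ ψ)))) (n / (2 * Real.pi)) =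
    flowSymbol t (n / (2 * Real.pi)) • (𝓕⁻ ψ) (n / (2 * Real.pi))
  rw [FourierTransform.fourierInv_fourier_eq,
    SchwartzMap.smulLeftCLM_apply_apply (flowSymbol_hasTemperateGrowth t)]

/-- The superposition `w⁻¹ ∑ c_j (1 + n²)^{(s-1)/2} exp (i n x)` over the frequencies `n = j/N`. -/
def stepL2 (s : ℝ) (N : ℕ) {S : Finset ℤ} (c : S → ℂ) : L2 :=
  ∑ j : S, (c j * (((1 + (((j : ℤ) : ℝ) / N) ^ 2) ^ ((s - 1) / 2) : ℝ) : ℂ)) •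
    waveL2 (((j : ℤ) : ℝ) / N)

theorem continuous_stepL2 (s : ℝ) (N : ℕ) (S : Finset ℤ) :
    Continuous fun c : S → ℂ => stepL2 s N c := by
  unfold stepL2
  fun_prop

theorem besselD_stepL2 (s : ℝ) (N : ℕ) {S : Finset ℤ} (c : S → ℂ) :
    besselD s (wtDist (stepL2 0 N c)) = wtDist (stepL2 s N c) := by
  simp only [stepL2, map_sum, map_smul, wtDist_waveL2, besselD_planeWave, smul_smul]
  refine Finset.sum_congr rfl fun j _ => ?_
  rw [mul_assoc, ← Complex.ofReal_mul, ← Real.rpow_add (by positivity)]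
  congr 4
  ring

theorem linFlow_stepL2 (t : ℝ) (N : ℕ) {S : Finset ℤ} (c : S → ℂ) :
    linFlow t (wtDist (stepL2 0 N c)) = wtDist (stepL2 0 N fun j : S =>
      flowSymbol t (((j : ℤ) : ℝ) / N / (2 * Real.pi)) * c j) := by
  simp only [stepL2, map_sum, map_smul, wtDist_waveL2, linFlow_planeWave, smul_smul]
  refine Finset.sum_congr rfl fun j _ => ?_
  congr 1
  ring

/-- The superposition `∑ c_j (1 + n²)^{-1/2} exp (i n x)` over the frequencies `n = j/N`. -/
def stepField (N : ℕ) {S : Finset ℤ} (c : S → ℂ) : HalfLoc :=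
  HalfLoc.ofTame (wtDist (stepL2 0 N c)) fun l => ⟨_, besselD_stepL2 (expo l) N c⟩

theorem besselD_stepField (s : ℝ) (N : ℕ) {S : Finset ℤ} (c : S → ℂ) :
    besselD s (stepField N c).val = wtDist (stepL2 s N c) := besselD_stepL2 s N c

theorem measurable_stepField (N : ℕ) (S : Finset ℤ) :
    Measurable fun c : S → ℂ => stepField N c := by
  rw [HalfLoc.measurable_iff_coord]
  intro n l
  simp only [HalfLoc.coord_of_wtDist (besselD_stepField (expo l) N _)]
  exact ((HalfLoc.cutL2 n).continuous.comp (continuous_stepL2 (expo l) N S)).measurable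

theorem flow_stepField (t : ℝ) (N : ℕ) {S : Finset ℤ} (c : S → ℂ) :
    HalfLoc.flow t (stepField N c) = stepField N fun j : S =>
      flowSymbol t (((j : ℤ) : ℝ) / N / (2 * Real.pi)) * c j :=
  HalfLoc.ext_val ((HalfLoc.flow_val (fun l => ⟨_, besselD_stepField (expo l) N c⟩) t).trans
    (linFlow_stepL2 t N c))

/-- The frequencies `j` of `φ_{N,R}`. -/
def freqs (N R : ℕ) : Finset ℤ := Finset.Ico (-((N : ℤ) * R)) ((N : ℤ) * R)

/-- The increments of `W` in `φ_{N,R}`. -/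
def incrs {Ω : Type*} (W : ℝ → Ω → ℂ) (N R : ℕ) (ω : Ω) : freqs N R → ℂ := fun j => incr W N j ω

theorem coeFn_stepL2_incrs {Ω : Type*} (W : ℝ → Ω → ℂ) (s : ℝ) (N R : ℕ) (ω : Ω) :
    stepL2 s N (incrs W N R ω) =ᵐ[volume] fun x => (wt x)⁻¹ * approxField W s N R ω x := by
  have h1 := Lp.coeFn_finsetSum (s := (Finset.univ : Finset (freqs N R)))
    (fun j => (incrs W N R ω j * (((1 + (((j : ℤ) : ℝ) / N) ^ 2) ^ ((s - 1) / 2) : ℝ) : ℂ)) •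
      waveL2 (((j : ℤ) : ℝ) / N))
  have h2 : ∀ᵐ x, ∀ j : freqs N R,
      ((incrs W N R ω j * (((1 + (((j : ℤ) : ℝ) / N) ^ 2) ^ ((s - 1) / 2) : ℝ) : ℂ)) •
        waveL2 (((j : ℤ) : ℝ) / N) : L2) x =
      (incrs W N R ω j * (((1 + (((j : ℤ) : ℝ) / N) ^ 2) ^ ((s - 1) / 2) : ℝ) : ℂ)) *
        ((wt x)⁻¹ * Complex.exp (Complex.I * (((j : ℤ) : ℝ) / N : ℝ) * x)) := by
    refine ae_all_iff.2 fun j => ?_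
    filter_upwards [Lp.coeFn_smul (incrs W N R ω j *
      (((1 + (((j : ℤ) : ℝ) / N) ^ 2) ^ ((s - 1) / 2) : ℝ) : ℂ)) (waveL2 (((j : ℤ) : ℝ) / N)),
      coeFn_waveL2 (((j : ℤ) : ℝ) / N)] with x h3 h4
    rw [h3, Pi.smul_apply, h4, smul_eq_mul]
  filter_upwards [h1, h2] with x hx1 hx2
  rw [stepL2, hx1, Finset.sum_apply, Finset.sum_congr rfl fun j _ => hx2 j, approxField_eq,
    Finset.mul_sum]
  refine (Finset.sum_coe_sort (freqs N R) (fun j : ℤ => incr W N j ω *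
    (((1 + ((j : ℝ) / N) ^ 2) ^ ((s - 1) / 2) : ℝ) : ℂ) *
      ((wt x)⁻¹ * Complex.exp (Complex.I * ((j : ℝ) / N : ℝ) * x)))).trans ?_
  refine Finset.sum_congr rfl fun j _ => ?_
  rw [integrand]
  ring

/-- That `w⁻¹ f` lies in `L²` need not be assumed: it is at finite distance from one of the `a j`.
-/
theorem exists_tendsto_of_lintegral {f : ℝ → ℂ} (hf : Measurable f) {A : ℕ → ℝ → ℂ} {a : ℕ → L2}
    (ha : ∀ j, a j =ᵐ[volume] fun x => (wt x)⁻¹ * A j x)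
    (h : Tendsto (fun j => ∫⁻ x, ‖(wt x)⁻¹ * (f x - A j x)‖ₑ ^ 2) atTop (𝓝 0)) :
    ∃ g : L2, (g =ᵐ[volume] fun x => (wt x)⁻¹ * f x) ∧ Tendsto a atTop (𝓝 g) := by
  have hm : AEStronglyMeasurable (fun x => (wt x)⁻¹ * f x) volume :=
    ((continuous_wt.inv₀ wt_ne_zero).measurable.mul hf).aestronglyMeasurable
  have heq : ∀ j, eLpNorm ((fun x => (wt x)⁻¹ * f x) - ⇑(a j)) 2 volume ^ 2 =
      ∫⁻ x, ‖(wt x)⁻¹ * (f x - A j x)‖ₑ ^ 2 := by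
    intro j
    rw [eLpNorm_two_sq]
    refine lintegral_congr_ae ?_
    filter_upwards [ha j] with x hx
    rw [Pi.sub_apply, hx, mul_sub]
  have hmem : MemLp (fun x => (wt x)⁻¹ * f x) 2 volume := by
    obtain ⟨j, hj⟩ := (h.eventually_lt_const ENNReal.zero_lt_top).exists
    have hd : MemLp ((fun x => (wt x)⁻¹ * f x) - ⇑(a j)) 2 volume := by
      refine ⟨hm.sub (Lp.aestronglyMeasurable _), ?_⟩
      rw [← heq] at hj
      exact (ENNReal.pow_lt_top_iff.1 hj).resolve_right two_ne_zero
    simpa using hd.add (Lp.memLp (a j))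
  refine ⟨hmem.toLp _, hmem.coeFn_toLp, ?_⟩
  rw [Lp.tendsto_Lp_iff_tendsto_eLpNorm']
  have hlim : Tendsto (fun j => eLpNorm ((fun x => (wt x)⁻¹ * f x) - ⇑(a j)) 2 volume) atTop
      (𝓝 0) := by
    replace h : Tendsto (fun j => eLpNorm ((fun x => (wt x)⁻¹ * f x) - ⇑(a j)) 2 volume ^ 2) atTop
        (𝓝 0) := by simpa only [heq] using h
    have h' := h.ennrpow_const (1 / 2)
    simp only [← ENNReal.rpow_natCast, ← ENNReal.rpow_mul] at h'
    simpa using h'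
  refine hlim.congr fun j => ?_
  rw [← eLpNorm_neg, neg_sub]
  refine eLpNorm_congr_ae ?_
  filter_upwards [hmem.coeFn_toLp] with x hx
  rw [Pi.sub_apply, Pi.sub_apply, hx]

theorem IsL2LocRep.congr_ae {T : 𝓢'(ℝ, ℂ)} {f g : ℝ → ℂ} (hf : IsL2LocRep T f)
    (h : f =ᵐ[volume] g) : IsL2LocRep T g := by
  refine ⟨fun R => (memLp_congr_ae (ae_restrict_of_ae h)).1 (hf.1 R), fun ψ hψ => ?_⟩
  rw [hf.2 ψ hψ]
  refine integral_congr_ae ?_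
  filter_upwards [h] with x hx
  rw [hx]

/-- The coordinate of index `1` carries the distribution itself, from which the other derivatives
are recovered. -/
theorem expo_one : expo 1 = 0 := by
  norm_num [expo]

/-- A sequence in `H^{1/2-}_loc` whose weighted derivatives converge has a limit. -/
theorem HalfLoc.exists_of_tendsto {f : ℕ → HalfLoc} {a : ℕ → ℕ → L2}
    (hf : ∀ j l, besselD (expo l) (f j).val = wtDist (a j l))
    (h : ∀ l, ∃ g, Tendsto (fun j => a j l) atTop (𝓝 g)) :
    ∃ (u : HalfLoc) (g : ℕ → L2), (∀ l, besselD (expo l) u.val = wtDist (g l)) ∧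
      ∀ l, Tendsto (fun j => a j l) atTop (𝓝 (g l)) := by
  choose g hg using h
  have hT : ∀ l, besselD (expo l) (wtDist (g 1)) = wtDist (g l) := by
    intro l
    have h1 : Tendsto (fun j => besselD (expo l) (wtDist (a j 1))) atTop
        (𝓝 (besselD (expo l) (wtDist (g 1)))) :=
      (((besselD (expo l)).continuous.comp wtDist.continuous).tendsto _).comp (hg 1)
    have h2 : Tendsto (fun j => wtDist (a j l)) atTop (𝓝 (wtDist (g l))) :=
      (wtDist.continuous.tendsto _).comp (hg l)
    refine tendsto_nhds_unique h1 (h2.congr fun j => ?_)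
    rw [← hf, ← hf, expo_one, besselD_zero]
  exact ⟨ofTame (wtDist (g 1)) fun l => ⟨_, hT l⟩, g, hT, hg⟩

/-! ### The Gaussian field -/

section

variable {Ω : Type*} [MeasurableSpace Ω] {P : Measure Ω} {W : ℝ → Ω → ℂ}

theorem IsComplexBrownian.measurable_incrs (hW : IsComplexBrownian W P) (N R : ℕ) :
    Measurable (incrs W N R) :=
  measurable_pi_iff.2 fun j => hW.measurable_incr N j

theorem IsComplexBrownian.measurable_weighted_sub (hW : IsComplexBrownian W P) (s : ℝ)
    {G : Ω → ℝ → ℂ} (hG : Measurable (Function.uncurry G)) (k : ℕ) :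
    Measurable (Function.uncurry fun ω x =>
      ‖(wt x)⁻¹ * (G ω x - approxField W s (2 ^ k) k ω x)‖ₑ ^ 2) := by
  have hw : Measurable fun x => (wt x)⁻¹ := (continuous_wt.inv₀ wt_ne_zero).measurable
  exact ((hw.comp measurable_snd).mul (hG.sub (hW.measurable_approxField s _ _))).enorm.pow_const 2

theorem IsComplexBrownian.tendsto_lintegral_weighted_sub [IsProbabilityMeasure P]
    (hW : IsComplexBrownian W P) {s : ℝ} (hs : s < 1 / 2) {G : Ω → ℝ → ℂ}
    (hG : Measurable (Function.uncurry G))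
    (h : ∀ k, ∀ᵐ x, ∫⁻ ω, ‖G ω x - approxField W s (2 ^ k) k ω x‖ₑ ^ 2 ∂P ≤
      ENNReal.ofReal ((1 + x ^ 2) ^ (1 / 4 : ℝ)) * cauchyErr s k) :
    Tendsto (fun k => ∫⁻ ω, ∫⁻ x,
      ‖(wt x)⁻¹ * (G ω x - approxField W s (2 ^ k) k ω x)‖ₑ ^ 2 ∂volume ∂P) atTop (𝓝 0) := by
  have hlim : Tendsto (fun k => wtConst * cauchyErr s k) atTop (𝓝 0) := by
    simpa using ENNReal.Tendsto.const_mul (tendsto_cauchyErr hs) (Or.inr wtConst_ne_top)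
  refine tendsto_of_tendsto_of_tendsto_of_le_of_le tendsto_const_nhds hlim (fun _ => zero_le)
    fun k => ?_
  rw [lintegral_lintegral_swap (hW.measurable_weighted_sub s hG k).aemeasurable]
  exact lintegral_lintegral_weighted_le (H := fun ω x => G ω x - approxField W s (2 ^ k) k ω x)
    (hG.sub (hW.measurable_approxField s _ _)) (h k)

/-- Along a subsequence, the approximations converge to a field in `H^{1/2-}_loc`. -/
theorem IsComplexBrownian.exists_field [IsProbabilityMeasure P] (hW : IsComplexBrownian W P) :
    ∃ (κ : ℕ → ℕ) (φ : Ω → HalfLoc) (g : Ω → ℕ → L2), StrictMono κ ∧ Measurable φ ∧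
      (∀ ω l, besselD (expo l) (φ ω).val = wtDist (g ω l)) ∧
      ∀ᵐ ω ∂P, ∀ l, Tendsto (fun j => stepL2 (expo l) (2 ^ κ j) (incrs W (2 ^ κ j) (κ j) ω))
        atTop (𝓝 (g ω l)) := by
  classical
  choose G hG hG' using fun l => hW.exists_limit (expo_lt l)
  obtain ⟨κ, hκ, hae⟩ := exists_strictMono_ae_tendsto_zero (P := P)
    (fun l k => (hW.measurable_weighted_sub (expo l) (hG l) k).lintegral_prod_right)
    fun l => hW.tendsto_lintegral_weighted_sub (expo_lt l) (hG l) (hG' l)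
  -- Replacing the increments by `0` off this measurable set of full measure makes the
  -- approximations converge for every `ω`. Then `φ` is a pointwise limit of measurable maps, and
  -- all its values are tame.
  let t : Set Ω := ⋂ l, {ω | ∃ g, Tendsto (fun j =>
    stepL2 (expo l) (2 ^ κ j) (incrs W (2 ^ κ j) (κ j) ω)) atTop (𝓝 g)}
  have ht : MeasurableSet t := MeasurableSet.iInter fun l => measurableSet_exists_tendsto fun j =>
    (continuous_stepL2 _ _ _).measurable.comp (hW.measurable_incrs _ _)
  have ht' : ∀ᵐ ω ∂P, ω ∈ t := by
    filter_upwards [hae] with ω hω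
    refine Set.mem_iInter.2 fun l => ?_
    obtain ⟨g, -, hg⟩ := exists_tendsto_of_lintegral ((hG l).of_uncurry_left (x := ω))
      (fun j => coeFn_stepL2_incrs W (expo l) (2 ^ κ j) (κ j) ω) (hω l)
    exact ⟨g, hg⟩
  let c : ∀ (j : ℕ) (_ : Ω), freqs (2 ^ κ j) (κ j) → ℂ := fun j =>
    t.indicator (incrs W (2 ^ κ j) (κ j))
  have hc : ∀ j, Measurable (c j) := fun j => (hW.measurable_incrs _ _).indicator ht
  have hlim : ∀ ω l, ∃ g, Tendsto (fun j => stepL2 (expo l) (2 ^ κ j) (c j ω)) atTop (𝓝 g) := by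
    intro ω l
    by_cases hω : ω ∈ t
    · simp only [c, Set.indicator_of_mem hω]
      exact Set.mem_iInter.1 hω l
    · refine ⟨0, tendsto_const_nhds.congr fun j => ?_⟩
      simp [c, Set.indicator_of_notMem hω, stepL2]
  choose φ g hφ hg using fun ω => HalfLoc.exists_of_tendsto
    (f := fun j => stepField (2 ^ κ j) (c j ω))
    (fun j l => besselD_stepField (expo l) (2 ^ κ j) (c j ω)) (hlim ω)
  refine ⟨κ, φ, g, hκ, ?_, hφ, ?_⟩
  · refine measurable_of_tendsto_metrizable
      (fun j => (measurable_stepField (2 ^ κ j) _).comp (hc j)) (tendsto_pi_nhds.2 fun ω => ?_)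
    exact HalfLoc.tendsto_of_tendsto_wtDist
      (fun j l => besselD_stepField (expo l) (2 ^ κ j) (c j ω)) (hφ ω) (hg ω)
  · filter_upwards [ht'] with ω hω
    simpa only [c, Set.indicator_of_mem hω] using hg ω

/-- For general `s` the mean-square limit `G` must be identified with `D^s φ`. Along a further
subsequence the approximations of order `s` converge to `G` in `w L²`, and to `D^s φ` as
distributions by continuity of `D^s`. -/
theorem IsComplexBrownian.isGaussianField [IsProbabilityMeasure P] (hW : IsComplexBrownian W P)
    {κ : ℕ → ℕ} (hκ : StrictMono κ) {φ : Ω → HalfLoc} (hφ : Measurable φ) {g : Ω → ℕ → L2}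
    (hg : ∀ ω l, besselD (expo l) (φ ω).val = wtDist (g ω l))
    (hlim : ∀ᵐ ω ∂P, ∀ l, Tendsto (fun j =>
      stepL2 (expo l) (2 ^ κ j) (incrs W (2 ^ κ j) (κ j) ω)) atTop (𝓝 (g ω l))) :
    IsGaussianField W P φ := by
  refine ⟨hφ, fun s hs => ?_⟩
  obtain ⟨G, hG, hG'⟩ := hW.exists_limit hs
  refine ⟨G, hG, ?_, tendsto_essSup_of_lintegral_le hs hG'⟩
  obtain ⟨ι, hι, hae⟩ := exists_strictMono_ae_tendsto_zero (P := P)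
    (fun _ k => (hW.measurable_weighted_sub s hG (κ k)).lintegral_prod_right)
    fun _ => (hW.tendsto_lintegral_weighted_sub hs hG hG').comp hκ.tendsto_atTop
  filter_upwards [hlim, hae] with ω h1 h2
  obtain ⟨g', hg', hlim'⟩ := exists_tendsto_of_lintegral (hG.of_uncurry_left (x := ω))
    (fun j => coeFn_stepL2_incrs W s (2 ^ κ (ι j)) (κ (ι j)) ω) (h2 0)
  have h3 : Tendsto (fun j => wtDist (stepL2 0 (2 ^ κ j) (incrs W (2 ^ κ j) (κ j) ω))) atTop
      (𝓝 (φ ω).val) := by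
    have h4 := (wtDist.continuous.tendsto _).comp (h1 1)
    rwa [← hg, expo_one, besselD_zero] at h4
  have h5 : Tendsto (fun j => wtDist (stepL2 s (2 ^ κ (ι j)) (incrs W (2 ^ κ (ι j)) (κ (ι j)) ω)))
      atTop (𝓝 (besselD s (φ ω).val)) := by
    refine (((besselD s).continuous.tendsto _).comp (h3.comp hι.tendsto_atTop)).congr fun j => ?_
    exact besselD_stepL2 s _ _
  rw [tendsto_nhds_unique h5 ((wtDist.continuous.tendsto _).comp hlim')]
  refine (isL2LocRep_wtDist g').congr_ae ?_
  filter_upwards [hg'] with x hx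
  rw [hx, mul_inv_cancel_left₀ (wt_ne_zero x)]

/-- At `s = 0` the two representatives are limits of the same sequence, so for almost every `x` they
agree almost surely. Joint measurability allows the quantifiers to be exchanged. -/
theorem IsGaussianField.ae_eq [IsProbabilityMeasure P] (hW : IsComplexBrownian W P)
    {φ φ' : Ω → HalfLoc} (hφ : IsGaussianField W P φ) (hφ' : IsGaussianField W P φ') :
    φ =ᵐ[P] φ' := by
  obtain ⟨G, hG, hrep, hlim⟩ := hφ.limit 0 (by norm_num)
  obtain ⟨G', hG', hrep', hlim'⟩ := hφ'.limit 0 (by norm_num)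
  have hsum := hlim.add hlim'
  rw [add_zero] at hsum
  have hx : ∀ᵐ x, ∀ᵐ ω ∂P, G ω x = G' ω x := by
    filter_upwards [ae_all_iff.2 fun k : ℕ => ENNReal.ae_le_essSup (μ := volume)
        (fun x : ℝ => ENNReal.ofReal ((1 + x ^ 2) ^ (-(1 / 2) : ℝ)) *
          eLpNorm (fun ω => G ω x - approxField W 0 (2 ^ k) k ω x) 2 P),
      ae_all_iff.2 fun k : ℕ => ENNReal.ae_le_essSup (μ := volume)
        (fun x : ℝ => ENNReal.ofReal ((1 + x ^ 2) ^ (-(1 / 2) : ℝ)) *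
          eLpNorm (fun ω => G' ω x - approxField W 0 (2 ^ k) k ω x) 2 P)] with x h1 h2
    have hGx : Measurable fun ω => G ω x := hG.of_uncurry_right
    have hGx' : Measurable fun ω => G' ω x := hG'.of_uncurry_right
    have hA : ∀ k, Measurable fun ω => approxField W 0 (2 ^ k) k ω x := fun k =>
      (hW.measurable_approxField 0 (2 ^ k) k).of_uncurry_right
    have hzero : ENNReal.ofReal ((1 + x ^ 2) ^ (-(1 / 2) : ℝ)) *
        eLpNorm ((fun ω => G ω x) - fun ω => G' ω x) 2 P = 0 := by
      refine le_antisymm (ge_of_tendsto' hsum fun k => ?_) zero_le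
      refine le_trans ?_ (add_le_add (h1 k) (h2 k))
      rw [← mul_add]
      gcongr
      have heq : ((fun ω => G ω x) - fun ω => G' ω x) =
          (fun ω => G ω x - approxField W 0 (2 ^ k) k ω x) -
            fun ω => G' ω x - approxField W 0 (2 ^ k) k ω x := by
        ext ω
        simp
      rw [heq]
      exact eLpNorm_sub_le (hGx.sub (hA k)).aestronglyMeasurable
        (hGx'.sub (hA k)).aestronglyMeasurable (by norm_num)
    have hw : ENNReal.ofReal ((1 + x ^ 2) ^ (-(1 / 2) : ℝ)) ≠ 0 := by
      rw [Ne, ENNReal.ofReal_eq_zero, not_le]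
      positivity
    have h0 := (mul_eq_zero.1 hzero).resolve_left hw
    rw [eLpNorm_eq_zero_iff (hGx.sub hGx').aestronglyMeasurable (by norm_num)] at h0
    filter_upwards [h0] with ω hω
    exact sub_eq_zero.1 hω
  rw [Measure.ae_ae_comm (p := fun x ω => G ω x = G' ω x) (measurableSet_eq_fun (hG.comp measurable_swap)
    (hG'.comp measurable_swap))] at hx
  filter_upwards [hrep, hrep', hx] with ω h1 h2 h3
  refine HalfLoc.ext_val (ext_of_hasCompactSupport fun ψ hψ => ?_)
  rw [besselD_zero] at h1 h2
  rw [h1.2 ψ hψ, h2.2 ψ hψ]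
  refine integral_congr_ae ?_
  filter_upwards [h3] with x hx
  rw [hx]

/-! ### Invariance under the flow -/

theorem norm_flowSymbol (t ξ : ℝ) : ‖flowSymbol t ξ‖ = 1 := by
  rw [flowSymbol, Complex.norm_exp]
  simp

/-- By independence the joint law is a product of circular Gaussians, and each factor is invariant
under its own rotation. -/
theorem IsComplexBrownian.map_incrs_rotate [IsProbabilityMeasure P] (hW : IsComplexBrownian W P)
    (N R : ℕ) {θ : freqs N R → ℂ} (hθ : ∀ j, ‖θ j‖ = 1) :
    (P.map (incrs W N R)).map (fun c j => θ j * c j) = P.map (incrs W N R) := by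
  have h : P.map (incrs W N R) =
      Measure.pi fun _ : freqs N R => complexGaussian (N : ℝ≥0)⁻¹ := by
    have h1 := (iIndepFun_iff_map_fun_eq_pi_map (μ := P)
      (f := fun j : freqs N R => incr W N (j : ℤ))
      fun j => (hW.measurable_incr N j).aemeasurable).1 (hW.iIndepFun_incr N _ _)
    simp only [(hW.hasLaw_incr N _).map_eq] at h1
    exact h1
  have hmap : ∀ j : freqs N R, (complexGaussian (N : ℝ≥0)⁻¹).map (fun z => θ j * z) =
      complexGaussian (N : ℝ≥0)⁻¹ := fun j => complexGaussian_map_mul _ (hθ j)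
  have : ∀ j : freqs N R, SigmaFinite ((complexGaussian (N : ℝ≥0)⁻¹).map (fun z => θ j * z)) :=
    fun j => by
      rw [hmap]
      infer_instance
  rw [h, Measure.pi_map_pi fun j => (measurable_const_mul (θ j)).aemeasurable]
  simp only [hmap]

theorem IsComplexBrownian.map_flow_stepField [IsProbabilityMeasure P]
    (hW : IsComplexBrownian W P) (t : ℝ) (N R : ℕ) :
    P.map (fun ω => HalfLoc.flow t (stepField N (incrs W N R ω))) =
      P.map fun ω => stepField N (incrs W N R ω) := by
  have hrot : Measurable fun (c : freqs N R → ℂ) (j : freqs N R) =>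
      flowSymbol t (((j : ℤ) : ℝ) / N / (2 * Real.pi)) * c j :=
    measurable_pi_iff.2 fun j => (measurable_pi_apply j).const_mul _
  have h := hW.map_incrs_rotate N R (θ := fun j =>
    flowSymbol t (((j : ℤ) : ℝ) / N / (2 * Real.pi))) fun j => norm_flowSymbol _ _
  have hs := measurable_stepField N (freqs N R)
  simp only [flow_stepField]
  calc _ = ((P.map (incrs W N R)).map fun (c : freqs N R → ℂ) (j : freqs N R) =>
          flowSymbol t (((j : ℤ) : ℝ) / N / (2 * Real.pi)) * c j).map
            fun c => stepField N c := by
        rw [Measure.map_map hs hrot, Measure.map_map (hs.comp hrot) (hW.measurable_incrs N R)]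
        rfl
    _ = _ := by
        rw [h, Measure.map_map hs (hW.measurable_incrs N R)]
        rfl

/-- Almost sure limits of random variables with equal laws have equal laws. -/
theorem map_eq_of_ae_tendsto {E : Type*} [PseudoMetricSpace E] [MeasurableSpace E] [BorelSpace E]
    [IsProbabilityMeasure P] {X Y : ℕ → Ω → E} {X₀ Y₀ : Ω → E} (hX : ∀ j, Measurable (X j))
    (hY : ∀ j, Measurable (Y j)) (hX₀ : Measurable X₀) (hY₀ : Measurable Y₀)
    (h : ∀ j, P.map (X j) = P.map (Y j))
    (hlimX : ∀ᵐ ω ∂P, Tendsto (fun j => X j ω) atTop (𝓝 (X₀ ω)))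
    (hlimY : ∀ᵐ ω ∂P, Tendsto (fun j => Y j ω) atTop (𝓝 (Y₀ ω))) : P.map X₀ = P.map Y₀ := by
  have := Measure.isProbabilityMeasure_map (μ := P) hX₀.aemeasurable
  have := Measure.isProbabilityMeasure_map (μ := P) hY₀.aemeasurable
  refine ext_of_forall_integral_eq_of_IsFiniteMeasure fun f => ?_
  have hfm : ∀ μ : Measure E, AEStronglyMeasurable f μ := fun μ =>
    f.continuous.measurable.aestronglyMeasurable
  have key : ∀ {Z : ℕ → Ω → E} {Z₀ : Ω → E}, (∀ j, Measurable (Z j)) → Measurable Z₀ →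
      (∀ᵐ ω ∂P, Tendsto (fun j => Z j ω) atTop (𝓝 (Z₀ ω))) →
      Tendsto (fun j => ∫ x, f x ∂(P.map (Z j))) atTop (𝓝 (∫ x, f x ∂(P.map Z₀))) := by
    intro Z Z₀ hZ hZ₀ hlim
    simp only [integral_map (hZ _).aemeasurable (hfm _), integral_map hZ₀.aemeasurable (hfm _)]
    refine tendsto_integral_of_dominated_convergence (fun _ => ‖f‖)
      (fun j => (f.continuous.measurable.comp (hZ j)).aestronglyMeasurable) (integrable_const _)
      (fun j => Eventually.of_forall fun ω => f.norm_coe_le_norm _) ?_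
    filter_upwards [hlim] with ω hω
    exact (f.continuous.tendsto _).comp hω
  refine tendsto_nhds_unique (key hX hX₀ hlimX) ?_
  simp only [h]
  exact key hY hY₀ hlimY

/-- As `tame` has full measure, `flowPreimage t A` differs from the Borel set `flow t ⁻¹' A` by a
null set. -/
theorem flowPreimage_of_map_flow_eq {μ : Measure HalfLoc} (hμ : μ HalfLoc.tameᶜ = 0) {t : ℝ}
    (h : μ.map (HalfLoc.flow t) = μ) {A : Set HalfLoc} (hA : MeasurableSet A) :
    NullMeasurableSet (flowPreimage t A) μ ∧ μ (flowPreimage t A) = μ A := by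
  have hm := HalfLoc.measurable_flow t hA
  have hae : flowPreimage t A =ᵐ[μ] HalfLoc.flow t ⁻¹' A := by
    have htame : ∀ᵐ u ∂μ, u ∈ HalfLoc.tame := hμ
    filter_upwards [htame] with u hu
    have h1 := congrArg (u ∈ ·) (HalfLoc.flowPreimage_inter_tame t A)
    have h2 : u ∈ flowPreimage t A ↔ u ∈ HalfLoc.flow t ⁻¹' A := by simpa [hu] using h1
    exact propext h2
  refine ⟨hm.nullMeasurableSet.congr hae.symm, ?_⟩
  rw [measure_congr hae, ← Measure.map_apply (HalfLoc.measurable_flow t) hA, h]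

end

end KleinGordon

end

/-! ### Existence, uniqueness and invariance -/

theorem mainTheorem2 {Ω : Type*} [MeasurableSpace Ω] (P : Measure Ω) [IsProbabilityMeasure P]
    (W : ℝ → Ω → ℂ) (hW : KleinGordon.IsComplexBrownian W P) :
    ∃ φ : Ω → KleinGordon.HalfLoc,
      KleinGordon.IsGaussianField W P φ ∧
      (∀ φ' : Ω → KleinGordon.HalfLoc, KleinGordon.IsGaussianField W P φ' → φ' =ᵐ[P] φ) ∧
      ∀ (t : ℝ) (A : Set KleinGordon.HalfLoc), MeasurableSet A →
        NullMeasurableSet (KleinGordon.flowPreimage t A) (P.map φ) ∧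
        P.map φ (KleinGordon.flowPreimage t A) = P.map φ A := by
  obtain ⟨κ, φ, g, hκ, hφ, hg, hlim⟩ := hW.exists_field
  have hfield := hW.isGaussianField hκ hφ hg hlim
  refine ⟨φ, hfield, fun φ' hφ' => hφ'.ae_eq hW hfield, fun t A hA => ?_⟩
  have hstep : ∀ j, Measurable fun ω => KleinGordon.stepField (2 ^ κ j)
      (KleinGordon.incrs W (2 ^ κ j) (κ j) ω) := fun j =>
    (KleinGordon.measurable_stepField _ _).comp (hW.measurable_incrs _ _)
  have hflow := KleinGordon.HalfLoc.measurable_flow t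
  refine KleinGordon.flowPreimage_of_map_flow_eq ?_ ?_ hA
  · rw [Measure.map_apply hφ KleinGordon.HalfLoc.measurableSet_tame.compl]
    have : φ ⁻¹' KleinGordon.HalfLoc.tameᶜ = ∅ :=
      Set.eq_empty_iff_forall_notMem.2 fun ω hω => hω fun l => ⟨_, hg ω l⟩
    rw [this, measure_empty]
  · rw [Measure.map_map hflow hφ]
    -- The step fields and their images under the flow have equal laws for each `j`. Both sequences
    -- converge almost surely, because the weighted derivatives converge in `L²`.
    refine KleinGordon.map_eq_of_ae_tendsto (fun j => hflow.comp (hstep j)) hstep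
      (hflow.comp hφ) hφ (fun j => hW.map_flow_stepField t (2 ^ κ j) (κ j)) ?_ ?_
    · filter_upwards [hlim] with ω hω
      exact KleinGordon.HalfLoc.tendsto_flow_of_tendsto_wtDist
        (fun j l => KleinGordon.besselD_stepField _ _ _) (hg ω) hω t
    · filter_upwards [hlim] with ω hω
      exact KleinGordon.HalfLoc.tendsto_of_tendsto_wtDist
        (fun j l => KleinGordon.besselD_stepField _ _ _) (hg ω) hω
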